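/- **Setting.** Let $h_1,h_2>0$ and let $\mathcal T_h$ be a finite non-empty set of open cells of size $h_1\times h_2$ of an axis-parallel Cartesian grid in $\mathbb R^2$ (with arbitrary origin). Let $\Omega$ be the interior of $\bigcup_{K\in\mathcal T_h}\overline K$, let $\Sigma_h$ be the set of edges and $\mathcal N_h$ the set of corners of the cells, and put $h=\max(h_1,h_2)$, $\rho=h/\min(h_1,h_2)$. Let $\kappa>0$ with $\kappa^2\ne\left(\frac{n\pi}{2h_1}\right)^2+\left(\frac{m\pi}{h_2}\right)^2$ for all integers $n,m\ge 0$. For $M\in\mathbb N$, $$\|u\|_{H^M_\kappa(\Omega)}^2=\sum_{|a|\le M}\kappa^{-2|a|}\,\|\partial^a u\|_{L^2(\Omega)}^2 .$$ For $n\ge1$ and $a,b>0$ let $$\widehat\varphi_n(x,y;a,b)=\sin(\kappa\nu x)\,\frac{\sin\left(y\kappa\sqrt{1-\nu^2}\right)}{\sin\left(b\kappa\sqrt{1-\nu^2}\right)},\qquad \nu=\frac{n\pi}{\kappa a},$$ with the principal square root. * For a horizontal edge $\mathbf s=[x_{\mathbf s},x_{\mathbf s}+h_1]\times\{y_{\mathbf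 s}\}$ let $\phi_{\mathbf s,n}(x,y)=\widehat\varphi_n(x-x_{\mathbf s},\,h_2-|y-y_{\mathbf s}|;\,h_1,h_2)$ if $x_{\mathbf s}\le x\le x_{\mathbf s}+h_1$ and $|y-y_{\mathbf s}|\le h_2$, and $\phi_{\mathbf s,n}(x,y)=0$ otherwise. * For a vertical edge $\mathbf s=\{x_{\mathbf s}\}\times[y_{\mathbf s},y_{\mathbf s}+h_2]$ let $\phi_{\mathbf s,n}(x,y)=\widehat\varphi_n(y-y_{\mathbf s},\,h_1-|x-x_{\mathbf s}|;\,h_2,h_1)$ if $y_{\mathbf s}\le y\le y_{\mathbf s}+h_2$ and $|x-x_{\mathbf s}|\le h_1$, and $\phi_{\mathbf s,n}(x,y)=0$ otherwise. * For a node $\mathbf p=(x_{\mathbf p},y_{\mathbf p})$ and $m\ge1$ let $\psi_{\mathbf p,m}(x,y)=\widehat\varphi_{2m-1}(x-x_{\mathbf p}+h_1,\,h_2-|y-y_{\mathbf p}|;\,2h_1,h_2)$ if $|x-x_{\mathbf p}|\le h_1$ and $|y-y_{\mathbf p}|\le h_2$, and $\psi_{\mathbf p,m}(x,y)=0$ otherwise.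 Let $u$ be a complex-valued function that is (real-)analytic on a neighbourhood of $\overline\Omega$ and satisfies $-\Delta u-\kappa^2u=0$ in $\Omega$. For $N_{\mathbf e},N_{\mathbf n}\ge1$, the node coefficients $\boldsymbol\beta=(\beta_{\mathbf p,m})_{\mathbf p\in\mathcal N_h,\,1\le m\le N_{\mathbf n}}$ are the solution of the collocation system $$\sum_{\mathbf p\in\mathcal N_h}\sum_{m=1}^{N_{\mathbf n}}\beta_{\mathbf p,m}\,(\kappa^{-1}\partial_1)^{2n}\psi_{\mathbf p,m}(\mathbf q)=(\kappa^{-1}\partial_1)^{2n}u(\mathbf q),\qquad \mathbf q\in\mathcal N_h,\quad 0\le n\le N_{\mathbf n}-1,$$ where $\partial_1^{2n}\psi_{\mathbf p,m}$ is taken cell by cell and its value at the node $\mathbf q$ is the limit from within the open cells. The edge coefficients are $$\alpha_{\mathbf s,n}=\frac{\left(u-\boldsymbol{\mathcal V}u,\ \phi_{\mathbf s,n}\right)_{L^2(\mathbf s)}}{\|\phi_{\mathbf s,n}\|_{L^2(\mathbf s)}^2},\qquad \mathbf s\in\Sigma_h,\ 1\le n\le N_{\mathbf e},\qquad\text{where}\quad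 \boldsymbol{\mathcal V}u=\sum_{\mathbf p\in\mathcal N_h}\sum_{m=1}^{N_{\mathbf n}}\beta_{\mathbf p,m}\psi_{\mathbf p,m}.$$ **Corollary (Analytic Helmholtz solution, stability).** There is a constant $C=C(\rho,\kappa h)>0$, depending only on $\rho$ and $\kappa h$, such that in the above setting, for all $N_{\mathbf e},N_{\mathbf n}\ge1$, the collocation system has exactly one solution $\boldsymbol\beta$, and $$\|\boldsymbol\alpha\|_{\ell^2}\le\frac Ch\,N_{\mathbf n}^2\,\|u\|_{H_\kappa^{2N_{\mathbf n}+1}(\Omega)},\qquad \|\boldsymbol\beta\|_{\ell^2}\le\frac Ch\,\sqrt{N_{\mathbf n}}\,\|u\|_{H_\kappa^{2N_{\mathbf n}+1}(\Omega)}.$$ In particular $C$ does not depend on $N_{\mathbf e}$, on $N_{\mathbf n}$, on $u$, or on the number of cells. -/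

import Mathlib

noncomputable section

namespace Trefftz

open scoped Topology

/-! ### Partial derivatives, Helmholtz equation and `κ`-weighted Sobolev norms in the plane -/

/-- The partial derivative `∂₁ f`. -/
def partialX (f : ℝ × ℝ → ℂ) : ℝ × ℝ → ℂ :=
  fun z => deriv (fun t : ℝ => f (t, z.2)) z.1

/-- The partial derivative `∂₂ f`. -/
def partialY (f : ℝ × ℝ → ℂ) : ℝ × ℝ → ℂ :=
  fun z => deriv (fun t : ℝ => f (z.1, t)) z.2

/-- `-Δ u - κ² u = 0` in `Ω`, pointwise. -/
def IsHelmholtzSolution (κ : ℝ) (Ω : Set (ℝ × ℝ)) (u : ℝ × ℝ → ℂ) : Prop :=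
  ∀ z ∈ Ω, -(partialX (partialX u) z + partialY (partialY u) z) - (κ : ℂ) ^ 2 * u z = 0

/-- The norm `‖u‖_{H_κ^M(Ω)}`, whose square is
`∑_{|a| ≤ M} κ^{-2|a|} ‖∂^a u‖²_{L²(Ω)}`, with classical derivatives. It is used for functions
analytic on a neighbourhood of the closure of a bounded open set `Ω`, for which the weak
derivatives are the classical ones and all the integrals are finite. -/
def sobolevNorm (κ : ℝ) (M : ℕ) (Ω : Set (ℝ × ℝ)) (u : ℝ × ℝ → ℂ) : ℝ :=
  Real.sqrt (∑ a ∈ (Finset.range (M + 1) ×ˢ Finset.range (M + 1)).filter (fun a => a.1 + a.2 ≤ M),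
    (κ ^ (2 * (a.1 + a.2)))⁻¹ * ∫ z in Ω, ‖(partialX^[a.1] (partialY^[a.2] u)) z‖ ^ 2)

/-- `(κ⁻¹ ∂₁)^k f`. -/
def scaledDerivX (κ : ℝ) (k : ℕ) (f : ℝ × ℝ → ℂ) : ℝ × ℝ → ℂ :=
  fun z => ((κ : ℂ) ^ k)⁻¹ * (partialX^[k] f) z

/-! ### The reference mode -/

/-- The Neumann eigenvalues of `-Δ` on a rectangle with side lengths `a` and `b`. -/
def neumannEigenvalues (a b : ℝ) : Set ℝ :=
  {l | ∃ n m : ℕ, l = (n * Real.pi / a) ^ 2 + (m * Real.pi / b) ^ 2}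

/-- The single-edge Helmholtz mode of index `n ≥ 1` on `(0, a) × (0, b)`:
`sin (κ ν x) sin (y κ √(1 - ν²)) / sin (b κ √(1 - ν²))` where `ν = n π / (κ a)`
and `√` is the principal square root of a complex number. -/
def mode (κ : ℝ) (n : ℕ) (x y a b : ℝ) : ℂ :=
  let ν : ℝ := n * Real.pi / (κ * a)
  let r : ℂ := ((1 - ν ^ 2 : ℝ) : ℂ) ^ (1 / 2 : ℂ)
  Complex.sin (κ * ν * x) * (Complex.sin (y * κ * r) / Complex.sin (b * κ * r))

/-! ### Cartesian meshes -/

/-- A finite mesh of open rectangular cells with sides `h₁` and `h₂`, taken from a Cartesian grid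
with an arbitrary origin. The pair `(i, j)` stands for the cell whose lower left corner is the
grid point `(x₀ + i h₁, y₀ + j h₂)`. -/
structure Mesh where
  h₁ : ℝ
  h₂ : ℝ
  x₀ : ℝ
  y₀ : ℝ
  h₁_pos : 0 < h₁
  h₂_pos : 0 < h₂
  cells : Finset (ℤ × ℤ)
  cells_nonempty : cells.Nonempty

namespace Mesh

variable (T : Mesh)

/-- The mesh size `h`. -/
def size : ℝ := max T.h₁ T.h₂

/-- The shape parameter `ρ`. -/
def shape : ℝ := T.size / min T.h₁ T.h₂

/-- The grid point with index `(i, j)`. -/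
def point (p : ℤ × ℤ) : ℝ × ℝ := (T.x₀ + p.1 * T.h₁, T.y₀ + p.2 * T.h₂)

/-- The open cell with index `(i, j)`. -/
def cell (c : ℤ × ℤ) : Set (ℝ × ℝ) :=
  Set.Ioo (T.point c).1 ((T.point c).1 + T.h₁) ×ˢ Set.Ioo (T.point c).2 ((T.point c).2 + T.h₂)

/-- The union of the open cells. -/
def cellUnion : Set (ℝ × ℝ) := ⋃ c ∈ T.cells, T.cell c

/-- The open set `Ω` that is tessellated by the mesh. -/
def domain : Set (ℝ × ℝ) := interior (⋃ c ∈ T.cells, closure (T.cell c))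

/-- The mesh nodes, interior and boundary: the corners of the cells. -/
def nodes : Finset (ℤ × ℤ) :=
  T.cells.biUnion fun c =>
    {(c.1, c.2), (c.1 + 1, c.2), (c.1, c.2 + 1), (c.1 + 1, c.2 + 1)}

/-- The horizontal mesh edges, each given by the index of its left end point. -/
def horizontalEdges : Finset (ℤ × ℤ) :=
  T.cells.biUnion fun c => {(c.1, c.2), (c.1, c.2 + 1)}

/-- The vertical mesh edges, each given by the index of its lower end point. -/
def verticalEdges : Finset (ℤ × ℤ) :=
  T.cells.biUnion fun c => {(c.1, c.2), (c.1 + 1, c.2)}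

/-- The mesh edges, interior and boundary: `Sum.inl p` is the horizontal edge with left end
point `p`, and `Sum.inr p` is the vertical edge with lower end point `p`. -/
def edges : Finset ((ℤ × ℤ) ⊕ (ℤ × ℤ)) := T.horizontalEdges.disjSum T.verticalEdges

/-- The length of an edge. -/
def edgeLength : (ℤ × ℤ) ⊕ (ℤ × ℤ) → ℝ
  | Sum.inl _ => T.h₁
  | Sum.inr _ => T.h₂

/-- The arc-length parametrization of an edge, over `[0, edgeLength]`. -/
def edgeParam : (ℤ × ℤ) ⊕ (ℤ × ℤ) → ℝ → ℝ × ℝ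
  | Sum.inl p, t => ((T.point p).1 + t, (T.point p).2)
  | Sum.inr p, t => ((T.point p).1, (T.point p).2 + t)

/-- The inner product `(f, g)_{L²(s)}` on an edge `s`. -/
def edgeInner (s : (ℤ × ℤ) ⊕ (ℤ × ℤ)) (f g : ℝ × ℝ → ℂ) : ℂ :=
  ∫ t in (0 : ℝ)..T.edgeLength s, f (T.edgeParam s t) * (starRingEnd ℂ) (g (T.edgeParam s t))

/-- The squared norm `‖f‖²_{L²(s)}` on an edge `s`. -/
def edgeNormSq (s : (ℤ × ℤ) ⊕ (ℤ × ℤ)) (f : ℝ × ℝ → ℂ) : ℝ :=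
  ∫ t in (0 : ℝ)..T.edgeLength s, ‖f (T.edgeParam s t)‖ ^ 2

/-! ### Edge and node basis functions -/

open Classical in
/-- The edge basis function `φ_{s,n}`, for `n ≥ 1`: on the closures of the two cells adjacent
to the edge `s` it is a reference mode, with non-zero trace on `s`; elsewhere it vanishes. -/
def edgeFun (κ : ℝ) (s : (ℤ × ℤ) ⊕ (ℤ × ℤ)) (n : ℕ) (z : ℝ × ℝ) : ℂ :=
  match s with
  | Sum.inl p =>
    let xs := (T.point p).1
    let ys := (T.point p).2
    if z ∈ Set.Icc xs (xs + T.h₁) ×ˢ Set.Icc ys (ys + T.h₂) then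
      mode κ n (z.1 - xs) (T.h₂ + (ys - z.2)) T.h₁ T.h₂
    else if z ∈ Set.Icc xs (xs + T.h₁) ×ˢ Set.Icc (ys - T.h₂) ys then
      mode κ n (z.1 - xs) (T.h₂ - (ys - z.2)) T.h₁ T.h₂
    else 0
  | Sum.inr p =>
    let xs := (T.point p).1
    let ys := (T.point p).2
    if z ∈ Set.Icc xs (xs + T.h₁) ×ˢ Set.Icc ys (ys + T.h₂) then
      mode κ n (z.2 - ys) (T.h₁ + (xs - z.1)) T.h₂ T.h₁
    else if z ∈ Set.Icc (xs - T.h₁) xs ×ˢ Set.Icc ys (ys + T.h₂) then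
      mode κ n (z.2 - ys) (T.h₁ - (xs - z.1)) T.h₂ T.h₁
    else 0

open Classical in
/-- The node basis function `ψ_{p,m}`, for `m ≥ 1`: on the closures of the two coarse cells of
size `2 h₁ × h₂` above and below the node `p` it is a reference mode of odd index `2 m - 1`;
elsewhere it vanishes. -/
def nodeFun (κ : ℝ) (p : ℤ × ℤ) (m : ℕ) (z : ℝ × ℝ) : ℂ :=
  let xp := (T.point p).1
  let yp := (T.point p).2
  if z ∈ Set.Icc (xp - T.h₁) (xp + T.h₁) ×ˢ Set.Icc yp (yp + T.h₂) then
    mode κ (2 * m - 1) (T.h₁ - (xp - z.1)) (T.h₂ + (yp - z.2)) (2 * T.h₁) T.h₂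
  else if z ∈ Set.Icc (xp - T.h₁) (xp + T.h₁) ×ˢ Set.Icc (yp - T.h₂) yp then
    mode κ (2 * m - 1) (T.h₁ - (xp - z.1)) (T.h₂ - (yp - z.2)) (2 * T.h₁) T.h₂
  else 0

/-! ### The coefficients of the combined interpolant

Coefficient vectors are elements of Euclidean spaces, so that `‖·‖` is the `ℓ²` norm. The index
`m : Fin N` stands for the number `m + 1` in `{1, …, N}`. -/

/-- The collocation system for `u`: for every node `q` and every `0 ≤ n ≤ N - 1`,
`∑_{p,m} β_{p,m} (κ⁻¹∂₁)^{2n} ψ_{p,m} (q) = (κ⁻¹∂₁)^{2n} u (q)`. The derivatives of the node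
functions are taken cell by cell; their values at the node `q` are the limits from within the
open cells of the mesh. -/
def IsCollocationSolution (κ : ℝ) (N : ℕ) (u : ℝ × ℝ → ℂ)
    (β : EuclideanSpace ℂ (T.nodes × Fin N)) : Prop :=
  ∀ q ∈ T.nodes, ∀ n < N,
    Filter.Tendsto
      (fun z => ∑ p : T.nodes, ∑ m : Fin N,
        β (p, m) * scaledDerivX κ (2 * n) (T.nodeFun κ p.1 (m.1 + 1)) z)
      (𝓝[T.cellUnion] (T.point q)) (𝓝 (scaledDerivX κ (2 * n) u (T.point q)))

/-- The nodal function `∑_{p,m} β_{p,m} ψ_{p,m}`. -/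
def nodalInterpolant (κ : ℝ) (N : ℕ) (β : EuclideanSpace ℂ (T.nodes × Fin N)) :
    ℝ × ℝ → ℂ :=
  fun z => ∑ p : T.nodes, ∑ m : Fin N, β (p, m) * T.nodeFun κ p.1 (m.1 + 1) z

/-- The edge coefficients `(w, φ_{s,n})_{L²(s)} / ‖φ_{s,n}‖²_{L²(s)}` of a function `w`, for
`s` an edge and `1 ≤ n ≤ N`. -/
def edgeCoefficients (κ : ℝ) (N : ℕ) (w : ℝ × ℝ → ℂ) :
    EuclideanSpace ℂ (T.edges × Fin N) :=
  WithLp.toLp 2 fun i =>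
    T.edgeInner i.1.1 w (T.edgeFun κ i.1.1 (i.2.1 + 1)) /
      (T.edgeNormSq i.1.1 (T.edgeFun κ i.1.1 (i.2.1 + 1)) : ℂ)

end Mesh

end Trefftz

end

noncomputable section

namespace Trefftz

open Finset MeasureTheory
open scoped Topology

section Vandermonde

open Polynomial

/-! ### The inverse of a Vandermonde matrix with nodes of one sign -/

/-! Each node function is a product of a sine in x and a ratio of sines in y, supported on the four
cells around its node. It vanishes at every other node, equals ±1 at its own, and on open cells the
operator (κ⁻¹∂₁)² multiplies it by -ν², with ν = (2m+1)π/(2κh₁) and m counted from 0. The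
collocation system therefore splits into one Vandermonde system per node, all with the same points
-ν² (`isCollocationSolution_iff`).

The point of the proof is that the inverse Vandermonde matrices have rows bounded in ℓ¹ uniformly in
their size. A row consists of the coefficients of a Lagrange polynomial; as all points have the same
sign, its ℓ¹ norm is, up to the normalization, the value at 1, namely ∏ (1 + c_k)/|c_k - c_m| with
c_k = ν_k². This splits into ∏ (1 + 1/c_k), bounded because ∑ 1/c_k converges, and ∏ c_k/|c_k -
c_m|, a ratio of odd squares with a closed form bounded by 2 (`exists_vandermonde_left_inverse`,
`exists_prod_node_ratio_le`). Summing over the N indices m costs the factor √N for β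
(`exists_collocationSolution`). The right-hand sides are nodal values of derivatives, controlled by
a Sobolev embedding on each cell (`sum_nodes_norm_sq_le`).

On its edge an edge function is a sine, so the edge coefficients are Fourier sine coefficients and
Bessel's inequality bounds them by the L² trace of u - 𝒱u, for any number of modes
(`sum_edgeCoefficients_le`). The trace of u is handled by a trace inequality. For 𝒱u, only the two
end points of an edge contribute, the modes are bounded uniformly in their index
(`norm_sin_div_sin_le`), and Cauchy–Schwarz in m reduces everything to ‖β‖
(`norm_edgeCoefficients_sq_le`). -/

lemma coeff_prod_X_add_C_nonneg {ι : Type*} (s : Finset ι) (c : ι → ℝ) (hc : ∀ k ∈ s, 0 ≤ c k)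
    (n : ℕ) : 0 ≤ (∏ k ∈ s, (X + C (c k))).coeff n := by
  classical
  induction s using Finset.induction_on generalizing n with
  | empty =>
    rw [prod_empty, coeff_one]
    split_ifs <;> norm_num
  | insert a s ha ih =>
    have ih' := ih fun k hk => hc k (mem_insert_of_mem hk)
    rw [prod_insert ha, add_mul, coeff_add, coeff_C_mul]
    have h1 := mul_nonneg (hc a (mem_insert_self a s)) (ih' n)
    cases n with
    | zero => simpa using h1
    | succ n =>
      rw [coeff_X_mul]
      exact add_nonneg (ih' n) h1

/-- Row m holds the coefficients of the Lagrange polynomial of the point -c_m. Its numerator ∏ (X +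
c_k) has nonnegative coefficients, so their absolute sum is simply its value at 1. -/
lemma exists_vandermonde_left_inverse {N : ℕ} (c : Fin N → ℝ) (hc : ∀ k, 0 ≤ c k)
    (hinj : Function.Injective c) :
    ∃ A : Fin N → Fin N → ℝ,
      (∀ m k, ∑ n : Fin N, A m n * (-c k) ^ (n : ℕ) = if m = k then 1 else 0) ∧
      ∀ m, ∑ n, |A m n| ≤ ∏ k ∈ univ.erase m, (1 + c k) / |c k - c m| := by
  classical
  set P : Fin N → ℝ[X] := fun m => ∏ k ∈ univ.erase m, (X + C (c k)) with hP
  have hdeg : ∀ m, (P m).natDegree < N := by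
    intro m
    have h1 : (P m).natDegree ≤ ∑ k ∈ univ.erase m, (X + C (c k)).natDegree :=
      natDegree_prod_le _ _
    have h2 : ∑ k ∈ univ.erase m, (X + C (c k)).natDegree = N - 1 := by
      simp [card_erase_of_mem]
    have := m.2
    omega
  have heval : ∀ m x, ∑ n : Fin N, (P m).coeff n * x ^ (n : ℕ) = (P m).eval x := by
    intro m x
    rw [eval_eq_sum_range' (hdeg m), Finset.sum_range]
  have hPe : ∀ m x, (P m).eval x = ∏ k ∈ univ.erase m, (x + c k) := by
    intro m x
    simp [hP, eval_prod]
  have hne : ∀ m, (P m).eval (-c m) ≠ 0 := by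
    intro m
    rw [hPe, prod_ne_zero_iff]
    intro k hk h0
    exact (ne_of_mem_erase hk) (hinj (by linarith))
  refine ⟨fun m n => (P m).coeff n / (P m).eval (-c m), fun m k => ?_, fun m => ?_⟩
  · simp only [div_mul_eq_mul_div]
    rw [← sum_div, heval]
    split_ifs with h
    · subst h
      exact div_self (hne m)
    · have : (P m).eval (-c k) = 0 := by
        rw [hPe, prod_eq_zero_iff]
        exact ⟨k, by simp [Ne.symm h], by ring⟩
      rw [this, zero_div]
  -- The factor 1 ^ n makes the coefficient sum an evaluation at 1.
  · have h1 : ∀ n : Fin N, |(P m).coeff n / (P m).eval (-c m)|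
        = (P m).coeff n * 1 ^ (n : ℕ) / |(P m).eval (-c m)| := by
      intro n
      rw [abs_div, abs_of_nonneg (coeff_prod_X_add_C_nonneg _ _ (fun k _ => hc k) n), one_pow,
        mul_one]
    simp only [h1]
    rw [← sum_div, heval, hPe, hPe, abs_prod, ← prod_div_distrib]
    refine le_of_eq (prod_congr rfl fun k _ => ?_)
    rw [show -c m + c k = c k - c m by ring]

end Vandermonde

/-! ### A product of ratios of odd squares -/

/-- The Wallis ratio `(2N)! / (4^N N!²)`. -/
def wallisRatio (N : ℕ) : ℝ := ∏ k ∈ range N, ((2 * k + 1 : ℝ) / (2 * k + 2))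

lemma wallisRatio_succ (N : ℕ) :
    wallisRatio (N + 1) = wallisRatio N * ((2 * N + 1 : ℝ) / (2 * N + 2)) := by
  rw [wallisRatio, prod_range_succ, ← wallisRatio]

/-- Passing from N to N + 1 multiplies the left side by (2N+1)(2N+3)/(2N+2)² < 1. -/
lemma wallisRatio_sq_le (N : ℕ) : wallisRatio N ^ 2 * (2 * N + 1) ≤ 1 := by
  induction N with
  | zero => simp [wallisRatio]
  | succ N ih =>
    rw [wallisRatio_succ]
    have h : (wallisRatio N * ((2 * N + 1 : ℝ) / (2 * N + 2))) ^ 2 * (2 * ((N + 1 : ℕ) : ℝ) + 1)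
        = wallisRatio N ^ 2 * (2 * N + 1) * ((2 * N + 1) * (2 * N + 3) / (2 * N + 2) ^ 2) := by
      push_cast
      field_simp
      ring
    rw [h]
    refine mul_le_one₀ ih (by positivity) ?_
    rw [div_le_one (by positivity)]
    nlinarith

/-- Since (2k+1)² - (2m+1)² = 4(k-m)(k+m+1), the denominators collect into a quotient of factorials,
while ∏ (2k+1) is the Wallis ratio times 2^N N!. -/
lemma prod_odd_ratio_below (m N : ℕ) (h : N ≤ m) :
    ∏ k ∈ range N, ((2 * k + 1 : ℝ) ^ 2 / |(2 * k + 1 : ℝ) ^ 2 - (2 * m + 1) ^ 2|) =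
      wallisRatio N ^ 2 * (N.factorial : ℝ) ^ 2 * ((m - N).factorial / (m + N).factorial) := by
  induction N with
  | zero =>
    have hf : (m.factorial : ℝ) ≠ 0 := Nat.cast_ne_zero.2 (Nat.factorial_ne_zero _)
    simp [wallisRatio, div_self hf]
  | succ N ih =>
    rw [prod_range_succ, ih (by omega), wallisRatio_succ]
    obtain ⟨d, rfl⟩ : ∃ d, m = N + 1 + d := ⟨m - (N + 1), by omega⟩
    have e1 : N + 1 + d - N = d + 1 := by omega
    have e2 : N + 1 + d - (N + 1) = d := by omega
    have e3 : N + 1 + d + (N + 1) = (N + 1 + d + N) + 1 := by omega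
    rw [e1, e2, e3, Nat.factorial_succ, Nat.factorial_succ, Nat.factorial_succ]
    have e4 : |(2 * (N : ℝ) + 1) ^ 2 - (2 * ((N + 1 + d : ℕ) : ℝ) + 1) ^ 2|
        = 4 * ((d : ℝ) + 1) * (2 * N + d + 2) := by
      rw [abs_sub_comm, abs_of_nonneg]
      · push_cast; ring
      · push_cast; nlinarith [(Nat.cast_nonneg d : (0 : ℝ) ≤ d), (Nat.cast_nonneg N : (0 : ℝ) ≤ N)]
    rw [e4]
    have hf : ((N + 1 + d + N).factorial : ℝ) ≠ 0 := Nat.cast_ne_zero.2 (Nat.factorial_ne_zero _)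
    push_cast
    field_simp
    ring

/-- Induction on the number d of factors above m; for d = 0 only the factors below m remain, which
are those of `prod_odd_ratio_below`. -/
lemma prod_odd_ratio (m d : ℕ) :
    ∏ k ∈ (range (m + 1 + d)).erase m,
      ((2 * k + 1 : ℝ) ^ 2 / |(2 * k + 1 : ℝ) ^ 2 - (2 * m + 1) ^ 2|) =
      4 * wallisRatio (m + 1 + d) ^ 2 * ((m + 1 + d).factorial : ℝ) ^ 2 /
        ((2 * m + 1) * d.factorial * (2 * m + 1 + d).factorial) := by
  induction d with
  | zero =>
    rw [add_zero, range_add_one, erase_insert (by simp), prod_odd_ratio_below m m le_rfl,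
      wallisRatio_succ, Nat.factorial_succ, add_zero, Nat.factorial_succ (2 * m), ← two_mul]
    have hf : ((2 * m).factorial : ℝ) ≠ 0 := Nat.cast_ne_zero.2 (Nat.factorial_ne_zero _)
    have hf' : (m.factorial : ℝ) ≠ 0 := Nat.cast_ne_zero.2 (Nat.factorial_ne_zero _)
    simp only [Nat.sub_self, Nat.factorial_zero]
    push_cast
    field_simp
    ring
  | succ d ih =>
    rw [← add_assoc, range_add_one, erase_insert_of_ne (by omega), prod_insert (by simp), ih,
      wallisRatio_succ, Nat.factorial_succ, Nat.factorial_succ, ← add_assoc (2 * m + 1),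
      Nat.factorial_succ (2 * m + 1 + d)]
    have e4 : |(2 * ((m + 1 + d : ℕ) : ℝ) + 1) ^ 2 - (2 * (m : ℝ) + 1) ^ 2|
        = 4 * ((d : ℝ) + 1) * (2 * m + d + 2) := by
      rw [abs_of_nonneg]
      · push_cast; ring
      · push_cast; nlinarith [(Nat.cast_nonneg d : (0 : ℝ) ≤ d), (Nat.cast_nonneg m : (0 : ℝ) ≤ m)]
    rw [e4]
    have hf : ((2 * m + 1 + d).factorial : ℝ) ≠ 0 := Nat.cast_ne_zero.2 (Nat.factorial_ne_zero _)
    have hf' : (d.factorial : ℝ) ≠ 0 := Nat.cast_ne_zero.2 (Nat.factorial_ne_zero _)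
    push_cast
    field_simp
    ring

/-- The induction hypothesis at d + 1 has the desired left side; on the right it remains to compare
the factors d + 1 and 2m + 3 + d. -/
lemma factorial_mul_factorial_le (m d : ℕ) :
    (m + 1 + d).factorial * (m + d).factorial ≤ d.factorial * (2 * m + 1 + d).factorial := by
  induction m generalizing d with
  | zero => simp [mul_comm, add_comm]
  | succ m ih =>
    have h := ih (d + 1)
    have e1 : m + 1 + (d + 1) = m + 1 + 1 + d := by omega
    have e2 : m + (d + 1) = m + 1 + d := by omega
    have e3 : 2 * m + 1 + (d + 1) = 2 * m + 2 + d := by omega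
    have e4 : 2 * (m + 1) + 1 + d = 2 * m + 2 + d + 1 := by omega
    rw [e1, e2, e3] at h
    rw [e4, Nat.factorial_succ (2 * m + 2 + d)]
    refine h.trans ?_
    rw [Nat.factorial_succ d]
    nlinarith [Nat.mul_le_mul_right (d.factorial * (2 * m + 2 + d).factorial)
      (show d + 1 ≤ 2 * m + 2 + d + 1 by omega)]

/-- In the closed form, N!² is at most N times the product of the two factorials in the denominator,
and the squared Wallis ratio is at most 1/(2N): what remains is 2/(2m+1). -/
lemma prod_odd_ratio_le {N m : ℕ} (hm : m < N) :
    ∏ k ∈ (range N).erase m,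
      ((2 * k + 1 : ℝ) ^ 2 / |(2 * k + 1 : ℝ) ^ 2 - (2 * m + 1) ^ 2|) ≤ 2 := by
  obtain ⟨d, rfl⟩ : ∃ d, N = m + 1 + d := ⟨N - (m + 1), by omega⟩
  rw [prod_odd_ratio]
  have hw := wallisRatio_sq_le (m + 1 + d)
  have hfac : (((m + 1 + d).factorial : ℝ) * (m + d).factorial) ≤
      d.factorial * (2 * m + 1 + d).factorial := by
    exact_mod_cast factorial_mul_factorial_le m d
  have hs : ((m + 1 + d).factorial : ℝ) = (m + 1 + d) * (m + d).factorial := by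
    rw [show m + 1 + d = m + d + 1 by omega, Nat.factorial_succ]
    push_cast
    ring
  have hd : (0 : ℝ) < d.factorial * (2 * m + 1 + d).factorial := by positivity
  rw [div_le_iff₀ (by positivity)]
  set D : ℝ := d.factorial * (2 * m + 1 + d).factorial
  set w := wallisRatio (m + 1 + d) ^ 2 with hw'
  have hw0 : 0 ≤ w := sq_nonneg _
  have h1 : ((m + 1 + d).factorial : ℝ) ^ 2 ≤ (m + 1 + d) * D := by
    calc ((m + 1 + d).factorial : ℝ) ^ 2
        = (m + 1 + d) * (((m + 1 + d).factorial : ℝ) * (m + d).factorial) := by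
          nth_rewrite 1 [sq, hs]; ring
      _ ≤ _ := by gcongr
  push_cast at hw
  have h2 : w * (2 * (m + 1 + d)) ≤ 1 := by nlinarith
  calc 4 * w * ((m + 1 + d).factorial : ℝ) ^ 2 ≤ 4 * w * ((m + 1 + d) * D) := by gcongr
    _ = 2 * (w * (2 * (m + 1 + d))) * D := by ring
    _ ≤ 2 * 1 * D := by gcongr
    _ ≤ 2 * ((2 * m + 1) * D) := by nlinarith [(Nat.cast_nonneg m : (0 : ℝ) ≤ m)]
    _ = _ := by simp only [D]; ring

/-- A bound for the Lebesgue-type products of the nodes `θ² (2k+1)²`, uniform in their number. -/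
lemma exists_prod_node_ratio_le {θ : ℝ} (hθ : 0 < θ) :
    ∃ B : ℝ, 0 < B ∧ ∀ (N : ℕ) (m : Fin N),
      ∏ k ∈ univ.erase m, (1 + ((2 * (k : ℕ) + 1) * θ) ^ 2) /
        |((2 * ((k : ℕ) : ℝ) + 1) * θ) ^ 2 - ((2 * ((m : ℕ) : ℝ) + 1) * θ) ^ 2| ≤ B := by
  have hsum : Summable fun k : ℕ => 1 / (((k + 1 : ℕ) : ℝ)) ^ 2 :=
    (summable_nat_add_iff 1).2 (Real.summable_one_div_nat_pow.2 one_lt_two)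
  set S := ∑' k : ℕ, 1 / (((k + 1 : ℕ) : ℝ)) ^ 2
  refine ⟨2 * Real.exp (S / θ ^ 2), by positivity, fun N m => ?_⟩
  set f : ℕ → ℝ := fun k => (2 * k + 1 : ℝ) ^ 2 / |(2 * k + 1 : ℝ) ^ 2 - (2 * (m : ℕ) + 1) ^ 2|
  -- Splits (1 + c)/|c - c_m| as c/|c - c_m| times 1 + 1/c; the scale θ cancels in the first factor.
  -- For k = m both sides are 0, as quotients by zero.
  have hfact : ∀ k : Fin N, (1 + ((2 * (k : ℕ) + 1) * θ) ^ 2) /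
        |((2 * ((k : ℕ) : ℝ) + 1) * θ) ^ 2 - ((2 * ((m : ℕ) : ℝ) + 1) * θ) ^ 2|
      = f k * (1 + 1 / ((2 * (k : ℕ) + 1) * θ) ^ 2) := by
    intro k
    have e : |((2 * ((k : ℕ) : ℝ) + 1) * θ) ^ 2 - ((2 * ((m : ℕ) : ℝ) + 1) * θ) ^ 2|
        = |(2 * ((k : ℕ) : ℝ) + 1) ^ 2 - (2 * ((m : ℕ) : ℝ) + 1) ^ 2| * θ ^ 2 := by
      rw [mul_pow, mul_pow, ← sub_mul, abs_mul, abs_of_nonneg (sq_nonneg θ)]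
    rw [e]
    simp only [f]
    by_cases h0 : |(2 * ((k : ℕ) : ℝ) + 1) ^ 2 - (2 * ((m : ℕ) : ℝ) + 1) ^ 2| = 0
    · simp [h0]
    · field_simp
      ring
  rw [prod_congr rfl fun k _ => hfact k, prod_mul_distrib]
  have h1 : ∏ k ∈ univ.erase m, f k ≤ 2 := by
    have := prod_odd_ratio_le m.2
    refine le_trans (le_of_eq ?_) this
    refine prod_bij (fun k _ => (k : ℕ)) ?_ ?_ ?_ ?_
    · intro k hk
      simp only [mem_erase, mem_univ, and_true, mem_range] at hk ⊢
      exact ⟨fun h => hk (Fin.ext h), k.2⟩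
    · intro a _ b _ h
      exact Fin.ext h
    · intro b hb
      simp only [mem_erase, mem_range] at hb
      exact ⟨⟨b, hb.2⟩, by simpa [Fin.ext_iff] using hb.1, rfl⟩
    · intro k _
      rfl
  have h2 : ∏ k ∈ univ.erase m, (1 + 1 / ((2 * ((k : ℕ) : ℝ) + 1) * θ) ^ 2)
      ≤ Real.exp (S / θ ^ 2) := by
    calc ∏ k ∈ univ.erase m, (1 + 1 / ((2 * ((k : ℕ) : ℝ) + 1) * θ) ^ 2)
        ≤ ∏ k ∈ univ.erase m, Real.exp (1 / (((k : ℕ) + 1 : ℕ) : ℝ) ^ 2 / θ ^ 2) := by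
          refine prod_le_prod (fun k _ => by positivity) fun k _ => ?_
          have : 1 / ((2 * ((k : ℕ) : ℝ) + 1) * θ) ^ 2 ≤ 1 / (((k : ℕ) + 1 : ℕ) : ℝ) ^ 2 / θ ^ 2 := by
            rw [div_div, mul_pow]
            push_cast
            have hk : (0 : ℝ) ≤ (k : ℕ) := Nat.cast_nonneg _
            gcongr
            linarith
          linarith [Real.add_one_le_exp (1 / (((k : ℕ) + 1 : ℕ) : ℝ) ^ 2 / θ ^ 2)]
      _ = Real.exp (∑ k ∈ univ.erase m, 1 / (((k : ℕ) + 1 : ℕ) : ℝ) ^ 2 / θ ^ 2) := by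
          rw [Real.exp_sum]
      _ ≤ Real.exp (S / θ ^ 2) := by
          rw [← sum_div]
          gcongr
          calc ∑ k ∈ univ.erase m, 1 / (((k : ℕ) + 1 : ℕ) : ℝ) ^ 2
              ≤ ∑ k : Fin N, 1 / (((k : ℕ) + 1 : ℕ) : ℝ) ^ 2 :=
                sum_le_sum_of_subset_of_nonneg (erase_subset _ _) fun _ _ _ => by positivity
            _ = ∑ k ∈ range N, 1 / ((k + 1 : ℕ) : ℝ) ^ 2 := by
                rw [Finset.sum_range]
            _ ≤ S := hsum.sum_le_tsum _ fun _ _ => by positivity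
  exact mul_le_mul h1 h2 (prod_nonneg fun _ _ => by positivity) (by norm_num)

/-! ### Fourier sine coefficients -/

lemma integral_cos_int_mul {L : ℝ} (hL : 0 < L) {j : ℤ} (hj : j ≠ 0) :
    ∫ t in (0 : ℝ)..L, Real.cos (j * Real.pi / L * t) = 0 := by
  have hc : (j * Real.pi / L : ℝ) ≠ 0 := by
    have : (j : ℝ) ≠ 0 := Int.cast_ne_zero.2 hj
    positivity
  rw [intervalIntegral.integral_comp_mul_left (fun t => Real.cos t) hc, integral_cos,
    div_mul_cancel₀ _ hL.ne', Real.sin_int_mul_pi]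
  simp

lemma integral_sin_mul_sin {L : ℝ} (hL : 0 < L) (n k : ℕ) :
    ∫ t in (0 : ℝ)..L, Real.sin ((n + 1 : ℕ) * Real.pi / L * t) *
      Real.sin ((k + 1 : ℕ) * Real.pi / L * t) = if n = k then L / 2 else 0 := by
  have h : ∀ t : ℝ, Real.sin ((n + 1 : ℕ) * Real.pi / L * t) *
      Real.sin ((k + 1 : ℕ) * Real.pi / L * t) =
      (1 / 2) * (Real.cos (((n : ℤ) - k : ℤ) * Real.pi / L * t) -
        Real.cos (((n : ℤ) + k + 2 : ℤ) * Real.pi / L * t)) := by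
    intro t
    have := Real.two_mul_sin_mul_sin ((n + 1 : ℕ) * Real.pi / L * t) ((k + 1 : ℕ) * Real.pi / L * t)
    rw [← sub_mul, ← add_mul, ← sub_div, ← add_div, ← sub_mul, ← add_mul] at this
    push_cast at this ⊢
    rw [show (n + 1 : ℝ) - (k + 1) = n - k by ring,
      show (n + 1 : ℝ) + (k + 1) = n + k + 2 by ring] at this
    linarith
  simp only [h]
  rw [intervalIntegral.integral_const_mul, intervalIntegral.integral_sub
    (Continuous.intervalIntegrable (by fun_prop) _ _)
    (Continuous.intervalIntegrable (by fun_prop) _ _),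
    integral_cos_int_mul hL (j := (n : ℤ) + k + 2) (by omega)]
  split_ifs with hnk
  · subst hnk
    simp
    ring
  · rw [integral_cos_int_mul hL (j := (n : ℤ) - k) (by omega)]
    simp

/-- Bessel's inequality for the Fourier sine coefficients on `[0, L]`. -/
lemma sine_bessel {L : ℝ} (hL : 0 < L) {w : ℝ → ℂ} (hw : ContinuousOn w (Set.Icc 0 L)) (N : ℕ) :
    ∑ n : Fin N, ‖(∫ t in (0 : ℝ)..L,
        w t * (Real.sin (((n : ℕ) + 1 : ℕ) * Real.pi / L * t) : ℂ)) / ((L / 2 : ℝ) : ℂ)‖ ^ 2 ≤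
      2 / L * ∫ t in (0 : ℝ)..L, ‖w t‖ ^ 2 := by
  set s : Fin N → ℝ → ℝ := fun n t => Real.sin (((n : ℕ) + 1 : ℕ) * Real.pi / L * t) with hs
  set α : Fin N → ℂ := fun n =>
    (∫ t in (0 : ℝ)..L, w t * (s n t : ℂ)) / ((L / 2 : ℝ) : ℂ) with hα
  have hsc : ∀ n, Continuous (s n) := fun n => by simp only [hs]; fun_prop
  set g : ℝ → ℂ := fun t => ∑ n, α n * (s n t : ℂ) with hg
  have hgc : Continuous g := by
    simp only [hg]
    exact continuous_finsetSum _ fun n _ =>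
      continuous_const.mul (Complex.continuous_ofReal.comp (hsc n))
  have hL2 : ((L / 2 : ℝ) : ℂ) ≠ 0 := by
    rw [Ne, Complex.ofReal_eq_zero]
    positivity
  have hint : ∀ f : ℝ → ℂ, ContinuousOn f (Set.Icc 0 L) →
      IntervalIntegrable f MeasureTheory.volume 0 L := fun f hf =>
    ContinuousOn.intervalIntegrable (by rwa [Set.uIcc_of_le hL.le])
  have hws : ∀ n, ∫ t in (0 : ℝ)..L, w t * (s n t : ℂ) = ((L / 2 : ℝ) : ℂ) * α n := by
    intro n
    simp only [hα]
    rw [mul_div_cancel₀ _ hL2]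
  have hgs : ∀ n, ∫ t in (0 : ℝ)..L, g t * (s n t : ℂ) = ((L / 2 : ℝ) : ℂ) * α n := by
    intro n
    have h1 : ∀ t, g t * (s n t : ℂ) = ∑ k, α k * ((s k t * s n t : ℝ) : ℂ) := by
      intro t
      simp only [hg]
      rw [sum_mul]
      refine sum_congr rfl fun k _ => ?_
      push_cast
      ring
    simp only [h1]
    rw [intervalIntegral.integral_finsetSum]
    · have h2 : ∀ k, ∫ t in (0 : ℝ)..L, α k * ((s k t * s n t : ℝ) : ℂ)
          = if k = n then ((L / 2 : ℝ) : ℂ) * α n else 0 := by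
        intro k
        rw [intervalIntegral.integral_const_mul, intervalIntegral.integral_ofReal]
        simp only [hs]
        rw [integral_sin_mul_sin hL]
        by_cases hkn : k = n
        · subst hkn
          simp [mul_comm]
        · simp [hkn, Fin.val_inj]
      exact (sum_congr rfl fun k _ => h2 k).trans (by rw [sum_ite_eq']; simp)
    · intro k _
      exact Continuous.intervalIntegrable (continuous_const.mul
        (Complex.continuous_ofReal.comp ((hsc k).mul (hsc n)))) _ _
  -- The inner product with g depends only on the sine coefficients, which w and its sine projection
  -- g share. Hence (w, g) = (g, g), and expanding ‖w - g‖² ≥ 0 gives the inequality.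
  have hconj : ∀ f : ℝ → ℂ, ContinuousOn f (Set.Icc 0 L) →
      (∀ n, ∫ t in (0 : ℝ)..L, f t * (s n t : ℂ) = ((L / 2 : ℝ) : ℂ) * α n) →
      ∫ t in (0 : ℝ)..L, f t * (starRingEnd ℂ) (g t) = ((L / 2 * ∑ n, ‖α n‖ ^ 2 : ℝ) : ℂ) := by
    intro f hf hfs
    have h1 : ∀ t, f t * (starRingEnd ℂ) (g t) =
        ∑ n, (starRingEnd ℂ) (α n) * (f t * (s n t : ℂ)) := by
      intro t
      simp only [hg, map_sum, map_mul, Complex.conj_ofReal]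
      rw [mul_sum]
      exact sum_congr rfl fun k _ => by ring
    simp only [h1]
    rw [intervalIntegral.integral_finsetSum]
    · simp only [intervalIntegral.integral_const_mul, hfs]
      push_cast
      rw [mul_sum]
      refine sum_congr rfl fun k _ => ?_
      rw [← Complex.conj_mul']
      ring
    · intro k _
      exact hint _ (continuousOn_const.mul (hf.mul
        (Complex.continuous_ofReal.comp (hsc k)).continuousOn))
  have hwg := hconj w hw hws
  have hgg := hconj g hgc.continuousOn hgs
  have hpt : ∀ t, ‖w t - g t‖ ^ 2 = ‖w t‖ ^ 2 - 2 * (w t * (starRingEnd ℂ) (g t)).re +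
      (g t * (starRingEnd ℂ) (g t)).re := by
    intro t
    rw [← Complex.normSq_eq_norm_sq, Complex.normSq_sub, Complex.mul_conj,
      Complex.normSq_eq_norm_sq]
    simp
    ring
  have hwg_int := hint (fun t => w t * (starRingEnd ℂ) (g t)) (hw.mul (Complex.continuous_conj.comp hgc).continuousOn)
  have hgg_int := hint (fun t => g t * (starRingEnd ℂ) (g t)) (hgc.continuousOn.mul (Complex.continuous_conj.comp hgc).continuousOn)
  have hww_int : IntervalIntegrable (fun t => ‖w t‖ ^ 2) MeasureTheory.volume 0 L :=
    ContinuousOn.intervalIntegrable (by rw [Set.uIcc_of_le hL.le]; exact hw.norm.pow 2)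
  have hre : ∀ f : ℝ → ℂ, IntervalIntegrable f MeasureTheory.volume 0 L →
      ∫ t in (0 : ℝ)..L, (f t).re = (∫ t in (0 : ℝ)..L, f t).re := by
    intro f hf
    exact Complex.reCLM.intervalIntegral_comp_comm hf
  have hre_int : ∀ f : ℝ → ℂ, IntervalIntegrable f MeasureTheory.volume 0 L →
      IntervalIntegrable (fun t => (f t).re) MeasureTheory.volume 0 L := by
    intro f hf
    exact ⟨hf.1.re, hf.2.re⟩
  have h0 : 0 ≤ ∫ t in (0 : ℝ)..L, ‖w t - g t‖ ^ 2 :=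
    intervalIntegral.integral_nonneg hL.le fun _ _ => by positivity
  simp only [hpt] at h0
  rw [intervalIntegral.integral_add (hww_int.sub ((hre_int _ hwg_int).const_mul 2))
      (hre_int _ hgg_int),
    intervalIntegral.integral_sub hww_int ((hre_int _ hwg_int).const_mul 2),
    intervalIntegral.integral_const_mul, hre _ hwg_int, hre _ hgg_int, hwg, hgg,
    Complex.ofReal_re] at h0
  have h3 : L / 2 * ∑ n, ‖α n‖ ^ 2 ≤ ∫ t in (0 : ℝ)..L, ‖w t‖ ^ 2 := by linarith
  calc ∑ n, ‖α n‖ ^ 2 = 2 / L * (L / 2 * ∑ n, ‖α n‖ ^ 2) := by field_simp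
    _ ≤ _ := by gcongr

/-! ### The Sobolev inequality on an interval -/

/-- Cauchy–Schwarz, obtained by integrating the square of g minus its mean. -/
lemma sq_integral_le {a b : ℝ} (hab : a < b) {g : ℝ → ℝ} (hg : ContinuousOn g (Set.Icc a b)) :
    (∫ t in a..b, g t) ^ 2 ≤ (b - a) * ∫ t in a..b, g t ^ 2 := by
  have hba : 0 < b - a := sub_pos.2 hab
  have hgi : IntervalIntegrable g MeasureTheory.volume a b :=
    ContinuousOn.intervalIntegrable (by rwa [Set.uIcc_of_le hab.le])
  have hg2 : IntervalIntegrable (fun t => g t ^ 2) MeasureTheory.volume a b :=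
    ContinuousOn.intervalIntegrable (by rw [Set.uIcc_of_le hab.le]; exact hg.pow 2)
  set I := ∫ t in a..b, g t
  have h0 : 0 ≤ ∫ t in a..b, ((g t ^ 2 - 2 * (I / (b - a)) * g t) + (I / (b - a)) ^ 2) := by
    refine intervalIntegral.integral_nonneg hab.le fun t _ => ?_
    nlinarith [sq_nonneg (g t - I / (b - a))]
  rw [intervalIntegral.integral_add (hg2.sub (hgi.const_mul _)) intervalIntegrable_const,
    intervalIntegral.integral_sub hg2 (hgi.const_mul _), intervalIntegral.integral_const_mul,
    intervalIntegral.integral_const] at h0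
  have h1 : 0 ≤ (b - a) * (∫ t in a..b, g t ^ 2) - I ^ 2 := by
    have := mul_nonneg hba.le h0
    refine this.trans (le_of_eq ?_)
    simp only [smul_eq_mul]
    field_simp
    ring
  linarith

/-- By the fundamental theorem of calculus f(s) differs from any f(t) by at most ∫ |f'|; square,
apply Cauchy–Schwarz and average over t. -/
lemma norm_sq_le_integral {a b : ℝ} (hab : a < b) {f f' : ℝ → ℂ}
    (hf : ∀ t ∈ Set.Icc a b, HasDerivAt f (f' t) t) (hf' : ContinuousOn f' (Set.Icc a b))
    {s : ℝ} (hs : s ∈ Set.Icc a b) :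
    ‖f s‖ ^ 2 ≤ 2 / (b - a) * (∫ t in a..b, ‖f t‖ ^ 2) +
      2 * (b - a) * ∫ t in a..b, ‖f' t‖ ^ 2 := by
  have hba : 0 < b - a := sub_pos.2 hab
  have hfc : ContinuousOn f (Set.Icc a b) := fun t ht => (hf t ht).continuousAt.continuousWithinAt
  have hpt : ∀ t ∈ Set.Icc a b, ‖f s‖ ^ 2 ≤
      2 * ‖f t‖ ^ 2 + 2 * ((b - a) * ∫ t in a..b, ‖f' t‖ ^ 2) := by
    intro t ht
    have hsub : Set.uIcc t s ⊆ Set.Icc a b := Set.uIcc_subset_Icc ht hs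
    have h1 : ∫ r in t..s, f' r = f s - f t :=
      intervalIntegral.integral_eq_sub_of_hasDerivAt (fun r hr => hf r (hsub hr))
        (hf'.mono hsub).intervalIntegrable
    have h2 : ‖f s - f t‖ ≤ ∫ r in a..b, ‖f' r‖ := by
      rw [← h1]
      refine intervalIntegral.norm_integral_le_integral_norm_uIoc.trans ?_
      rw [intervalIntegral.integral_of_le hab.le]
      refine MeasureTheory.setIntegral_mono_set ?_ ?_ ?_
      · exact (hf'.norm.integrableOn_Icc).mono_set Set.Ioc_subset_Icc_self
      · exact Filter.Eventually.of_forall fun _ => norm_nonneg _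
      · refine Filter.Eventually.of_forall fun x hx => ?_
        exact ⟨lt_of_le_of_lt (le_min ht.1 hs.1) hx.1, hx.2.trans (max_le ht.2 hs.2)⟩
    have h3 := sq_integral_le hab hf'.norm
    have h4 : ‖f s‖ ≤ ‖f t‖ + ‖f s - f t‖ := by
      simpa using norm_add_le (f t) (f s - f t)
    have h5 : ‖f s - f t‖ ^ 2 ≤ (∫ r in a..b, ‖f' r‖) ^ 2 := by gcongr
    nlinarith [sq_nonneg (‖f t‖ - ‖f s - f t‖), norm_nonneg (f s), norm_nonneg (f t),
      norm_nonneg (f s - f t)]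
  have hi : IntervalIntegrable (fun t => ‖f t‖ ^ 2) MeasureTheory.volume a b :=
    ContinuousOn.intervalIntegrable (by rw [Set.uIcc_of_le hab.le]; exact hfc.norm.pow 2)
  have hm := intervalIntegral.integral_mono_on hab.le (intervalIntegrable_const (c := ‖f s‖ ^ 2))
    ((hi.const_mul 2).add intervalIntegrable_const) hpt
  rw [intervalIntegral.integral_const, intervalIntegral.integral_add (hi.const_mul 2)
    intervalIntegrable_const, intervalIntegral.integral_const_mul,
    intervalIntegral.integral_const, smul_eq_mul, smul_eq_mul] at hm
  have := div_le_div_of_nonneg_right hm hba.le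
  rw [mul_div_cancel_left₀ _ hba.ne'] at this
  refine this.trans (le_of_eq ?_)
  field_simp

/-! ### The reference mode -/

/-- The number `√(1 - ν²)` with `ν = n π / α`. -/
def modeRoot (α : ℝ) (n : ℕ) : ℂ := ((1 - (n * Real.pi / α) ^ 2 : ℝ) : ℂ) ^ (1 / 2 : ℂ)

lemma modeRoot_sq (α : ℝ) (n : ℕ) :
    modeRoot α n ^ 2 = ((1 - (n * Real.pi / α) ^ 2 : ℝ) : ℂ) := by
  have := Complex.cpow_nat_inv_pow ((1 - (n * Real.pi / α) ^ 2 : ℝ) : ℂ) two_ne_zero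
  rw [modeRoot, one_div]
  exact_mod_cast this

/-- A zero would force bκ√(1-ν²) = kπ with k an integer; squared, this is a resonance. -/
lemma sin_mul_modeRoot_ne_zero {κ a b : ℝ} (hκ : 0 < κ) (ha : 0 < a) (hb : 0 < b) {n : ℕ}
    (h : ∀ k : ℕ, κ ^ 2 ≠ (n * Real.pi / a) ^ 2 + (k * Real.pi / b) ^ 2) :
    Complex.sin (b * κ * modeRoot (κ * a) n) ≠ 0 := by
  intro h0
  obtain ⟨k, hk⟩ := Complex.sin_eq_zero_iff.1 h0
  have h1 : (b * κ * modeRoot (κ * a) n) ^ 2 = (k * Real.pi : ℂ) ^ 2 := by rw [hk]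
  rw [mul_pow, modeRoot_sq] at h1
  have h2 : (b * κ) ^ 2 * (1 - (n * Real.pi / (κ * a)) ^ 2) = (k * Real.pi) ^ 2 := by
    exact_mod_cast h1
  refine h k.natAbs ?_
  have h3 : ((k.natAbs : ℕ) : ℝ) ^ 2 = (k : ℝ) ^ 2 := by
    rw [Nat.cast_natAbs]
    push_cast
    exact sq_abs _
  rw [div_pow, div_pow, mul_pow (k.natAbs : ℝ), h3, ← mul_pow, ← h2]
  field_simp
  ring

/-- A bound, uniform in `n`, for `sin (t √(1 - ν²)) / sin (β √(1 - ν²))`, `0 ≤ t ≤ β`. -/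
def modeBound (α β : ℝ) : ℝ :=
  1 + ∑ n ∈ range (⌈α⌉₊ + 1), ‖Complex.sin (β * modeRoot α n)‖⁻¹

lemma one_le_modeBound (α β : ℝ) : 1 ≤ modeBound α β :=
  le_add_of_nonneg_right (sum_nonneg fun _ _ => by positivity)

/-- For ν ≤ 1 the root is real, the numerator is at most 1, and n ≤ α leaves finitely many
denominators, all listed in `modeBound`. For ν > 1 the root is imaginary and the quotient is one of
hyperbolic sines, at most 1 by monotonicity. -/
lemma norm_sin_div_sin_le {α β : ℝ} (hα : 0 < α) {n : ℕ} {t : ℝ} (ht0 : 0 ≤ t) (ht : t ≤ β) :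
    ‖Complex.sin (t * modeRoot α n) / Complex.sin (β * modeRoot α n)‖ ≤ modeBound α β := by
  rcases le_or_gt (n * Real.pi / α) 1 with hν | hν
  · have hν0 : 0 ≤ n * Real.pi / α := by positivity
    have h0 : 0 ≤ 1 - (n * Real.pi / α) ^ 2 := by nlinarith
    have hr : modeRoot α n = (((1 - (n * Real.pi / α) ^ 2) ^ (1 / 2 : ℝ) : ℝ) : ℂ) := by
      rw [modeRoot, Complex.ofReal_cpow h0]
      push_cast
      rfl
    have h1 : ‖Complex.sin (t * modeRoot α n)‖ ≤ 1 := by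
      rw [hr, ← Complex.ofReal_mul, ← Complex.ofReal_sin, Complex.norm_real]
      exact Real.abs_sin_le_one _
    have hn : n ∈ range (⌈α⌉₊ + 1) := by
      rw [mem_range, Nat.lt_succ_iff]
      rw [div_le_one hα] at hν
      have h2 : (n : ℝ) ≤ α := by
        nlinarith [Real.pi_gt_three, (Nat.cast_nonneg n : (0 : ℝ) ≤ n)]
      exact_mod_cast h2.trans (Nat.le_ceil α)
    rw [norm_div, div_eq_mul_inv]
    calc ‖Complex.sin (t * modeRoot α n)‖ * ‖Complex.sin (β * modeRoot α n)‖⁻¹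
        ≤ 1 * ‖Complex.sin (β * modeRoot α n)‖⁻¹ := by gcongr
      _ ≤ ∑ n ∈ range (⌈α⌉₊ + 1), ‖Complex.sin (β * modeRoot α n)‖⁻¹ := by
          rw [one_mul]
          exact single_le_sum (f := fun n => ‖Complex.sin (β * modeRoot α n)‖⁻¹)
            (fun _ _ => by positivity) hn
      _ ≤ _ := by rw [modeBound]; linarith
  · have h0 : 0 ≤ (n * Real.pi / α) ^ 2 - 1 := by nlinarith
    set s := Real.sqrt ((n * Real.pi / α) ^ 2 - 1)
    have hs : 0 ≤ s := Real.sqrt_nonneg _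
    have hr : modeRoot α n ^ 2 = (s * Complex.I) ^ 2 := by
      have hs2 : (s : ℂ) ^ 2 = (((n * Real.pi / α) ^ 2 - 1 : ℝ) : ℂ) := by
        rw [← Complex.ofReal_pow, Real.sq_sqrt h0]
      rw [modeRoot_sq, mul_pow, Complex.I_sq, hs2]
      push_cast
      ring
    have hn : ∀ x : ℝ, 0 ≤ x → ‖Complex.sin (x * modeRoot α n)‖ = Real.sinh (x * s) := by
      intro x hx
      have h1 : ‖Complex.sin ((x * s : ℝ) * Complex.I)‖ = Real.sinh (x * s) := by
        rw [Complex.sin_mul_I, norm_mul, Complex.norm_I, mul_one, ← Complex.ofReal_sinh,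
          Complex.norm_real, Real.norm_of_nonneg (Real.sinh_nonneg_iff.2 (by positivity))]
      -- The sign of the root is irrelevant, the sine being odd.
      rcases sq_eq_sq_iff_eq_or_eq_neg.1 hr with h | h
      · rw [h, ← h1]
        push_cast
        rw [mul_assoc]
      · rw [h, mul_neg, Complex.sin_neg, norm_neg, ← h1]
        push_cast
        rw [mul_assoc]
    rw [norm_div, hn t ht0, hn β (ht0.trans ht)]
    refine le_trans (div_le_one_of_le₀ ?_ ?_) (one_le_modeBound α β)
    · exact Real.sinh_le_sinh.2 (by gcongr)
    · exact Real.sinh_nonneg_iff.2 (mul_nonneg (ht0.trans ht) hs)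

lemma mode_eq (κ : ℝ) (n : ℕ) (x y a b : ℝ) :
    mode κ n x y a b = Complex.sin (κ * (n * Real.pi / (κ * a) : ℝ) * x) *
      (Complex.sin (y * κ * modeRoot (κ * a) n) / Complex.sin (b * κ * modeRoot (κ * a) n)) :=
  rfl

lemma mode_eq_real_sin {κ : ℝ} (hκ : 0 < κ) (n : ℕ) (x y a b : ℝ) :
    mode κ n x y a b = (Real.sin (n * Real.pi / a * x) : ℂ) *
      (Complex.sin (y * κ * modeRoot (κ * a) n) / Complex.sin (b * κ * modeRoot (κ * a) n)) := by
  rw [mode_eq]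
  congr 1
  rw [Complex.ofReal_sin]
  congr 1
  have : κ * (n * Real.pi / (κ * a)) * x = n * Real.pi / a * x := by
    rw [← mul_div_assoc, mul_div_mul_left _ _ hκ.ne']
  exact_mod_cast this

/-! ### Iterated derivatives of eigenfunctions of the second derivative -/

lemma partialX_iterate (k : ℕ) (f : ℝ × ℝ → ℂ) (z : ℝ × ℝ) :
    (partialX^[k] f) z = (deriv^[k] fun t => f (t, z.2)) z.1 := by
  induction k generalizing z with
  | zero => rfl
  | succ k ih =>
    rw [Function.iterate_succ_apply', Function.iterate_succ_apply', partialX]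
    simp only [ih]

/-- Openness of U lets the induction hypothesis be differentiated twice. No regularity of f is
needed, since constant factors always pass through `deriv` over a field. -/
lemma deriv_iterate_two_mul_eqOn {f : ℝ → ℂ} {U : Set ℝ} (hU : IsOpen U) {l : ℂ}
    (h : ∀ t ∈ U, deriv (deriv f) t = l * f t) (n : ℕ) :
    ∀ t ∈ U, (deriv^[2 * n] f) t = l ^ n * f t := by
  induction n with
  | zero => simp
  | succ n ih =>
    intro t ht
    have h1 : deriv^[2 * n] f =ᶠ[𝓝 t] fun t => l ^ n * f t :=
      Filter.eventually_of_mem (hU.mem_nhds ht) ih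
    rw [show 2 * (n + 1) = 2 * n + 1 + 1 by ring, Function.iterate_succ_apply',
      Function.iterate_succ_apply', h1.deriv.deriv_eq]
    have h2 : deriv (fun t => l ^ n * f t) = fun t => l ^ n * deriv f t := by
      funext s
      exact deriv_const_mul_field _
    rw [h2, deriv_const_mul_field, h t ht]
    ring

lemma deriv_deriv_sin_mul_const (ω d : ℝ) (c : ℂ) (t : ℝ) :
    deriv (deriv fun t : ℝ => (Real.sin (ω * (d + t)) : ℂ) * c) t =
      -(ω : ℂ) ^ 2 * ((Real.sin (ω * (d + t)) : ℂ) * c) := by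
  have hl : ∀ t : ℝ, HasDerivAt (fun t : ℝ => ω * (d + t)) ω t := fun t => by
    simpa using ((hasDerivAt_id t).const_add d).const_mul ω
  have h1 : (deriv fun t : ℝ => (Real.sin (ω * (d + t)) : ℂ) * c) =
      fun t => ((Real.cos (ω * (d + t)) * ω : ℝ) : ℂ) * c := by
    funext s
    exact (((hl s).sin).ofReal_comp.mul_const c).deriv
  rw [h1]
  have h2 : HasDerivAt (fun t : ℝ => ((Real.cos (ω * (d + t)) * ω : ℝ) : ℂ) * c)
      (((-Real.sin (ω * (d + t)) * ω * ω : ℝ) : ℂ) * c) t :=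
    (((hl t).cos).mul_const ω).ofReal_comp.mul_const c
  rw [h2.deriv]
  push_cast
  ring

namespace Mesh

variable (T : Mesh)

/-! ### Node functions -/

/-- The factor of a node function that depends on the horizontal distance to the node. -/
def nodeX (m : ℕ) (t : ℝ) : ℝ :=
  Real.sin (((2 * m - 1 : ℕ) : ℝ) * Real.pi / (2 * T.h₁) * max 0 (min (2 * T.h₁) (T.h₁ + t)))

/-- The factor of a node function that depends on the vertical distance to the node. -/
def nodeY (κ : ℝ) (m : ℕ) (t : ℝ) : ℂ :=
  Complex.sin (((max 0 (T.h₂ - |t|) * κ : ℝ) : ℂ) * modeRoot (κ * (2 * T.h₁)) (2 * m - 1)) /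
    Complex.sin (T.h₂ * κ * modeRoot (κ * (2 * T.h₁)) (2 * m - 1))

lemma nodeX_of_mem {m : ℕ} {t : ℝ} (h : |t| ≤ T.h₁) :
    T.nodeX m t = Real.sin (((2 * m - 1 : ℕ) : ℝ) * Real.pi / (2 * T.h₁) * (T.h₁ + t)) := by
  rw [abs_le] at h
  rw [nodeX, min_eq_right (by linarith), max_eq_right (by linarith)]

/-- The clamp in `nodeX` stops the argument at 0 or 2h₁, where the sine vanishes, so clamping
amounts to extension by zero. -/
lemma nodeX_of_le {m : ℕ} {t : ℝ} (h : T.h₁ ≤ |t|) : T.nodeX m t = 0 := by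
  have h1 := T.h₁_pos
  rw [nodeX]
  rcases le_abs.1 h with h | h
  · rw [min_eq_left (by linarith), max_eq_right (by linarith),
      div_mul_cancel₀ _ (by positivity)]
    exact Real.sin_nat_mul_pi _
  · rw [max_eq_left ((min_le_right _ _).trans (by linarith)), mul_zero, Real.sin_zero]

lemma nodeY_of_le {κ : ℝ} {m : ℕ} {t : ℝ} (h : T.h₂ ≤ |t|) : T.nodeY κ m t = 0 := by
  rw [nodeY, max_eq_left (by linarith)]
  simp

lemma continuous_nodeX (m : ℕ) : Continuous (T.nodeX m) := by
  unfold nodeX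
  fun_prop

lemma continuous_nodeY (κ : ℝ) (m : ℕ) : Continuous (T.nodeY κ m) := by
  unfold nodeY
  fun_prop

/-- Replaces the case distinction by a product of continuous one-variable factors, from which
continuity, support and bounds are read off. -/
lemma nodeFun_eq {κ : ℝ} (hκ : 0 < κ) (p : ℤ × ℤ) (m : ℕ) (z : ℝ × ℝ) :
    T.nodeFun κ p m z =
      (T.nodeX m (z.1 - (T.point p).1) : ℂ) * T.nodeY κ m (z.2 - (T.point p).2) := by
  have h1 := T.h₁_pos
  have h2 := T.h₂_pos
  rw [nodeFun]
  simp only [Set.mem_prod, Set.mem_Icc]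
  split_ifs with ha hb
  · rw [T.nodeX_of_mem (abs_le.2 ⟨by linarith, by linarith⟩), nodeY,
      abs_of_nonneg (by linarith), max_eq_right (by linarith), mode_eq_real_sin hκ]
    push_cast
    rw [show (T.h₁ : ℂ) - ((T.point p).1 - z.1) = T.h₁ + (z.1 - (T.point p).1) by ring,
      show (T.h₂ : ℂ) + ((T.point p).2 - z.2) = T.h₂ - (z.2 - (T.point p).2) by ring]
  · rw [T.nodeX_of_mem (abs_le.2 ⟨by linarith, by linarith⟩), nodeY,
      abs_of_nonpos (by linarith), max_eq_right (by linarith), mode_eq_real_sin hκ]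
    push_cast
    rw [show (T.h₁ : ℂ) - ((T.point p).1 - z.1) = T.h₁ + (z.1 - (T.point p).1) by ring,
      show (T.h₂ : ℂ) - ((T.point p).2 - z.2) = T.h₂ - -(z.2 - (T.point p).2) by ring]
  · by_cases hx : T.h₁ ≤ |z.1 - (T.point p).1|
    · rw [T.nodeX_of_le hx]
      simp
    · by_cases hy : T.h₂ ≤ |z.2 - (T.point p).2|
      · rw [T.nodeY_of_le hy]
        simp
      · exfalso
        rw [not_le, abs_lt] at hx hy
        rcases le_total (T.point p).2 z.2 with h | h
        · exact ha ⟨⟨by linarith, by linarith⟩, h, by linarith⟩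
        · exact hb ⟨⟨by linarith, by linarith⟩, by linarith, h⟩

lemma continuous_nodeFun {κ : ℝ} (hκ : 0 < κ) (p : ℤ × ℤ) (m : ℕ) :
    Continuous (T.nodeFun κ p m) := by
  have hX := T.continuous_nodeX m
  have hY := T.continuous_nodeY κ m
  have : T.nodeFun κ p m = fun z =>
      (T.nodeX m (z.1 - (T.point p).1) : ℂ) * T.nodeY κ m (z.2 - (T.point p).2) :=
    funext (T.nodeFun_eq hκ p m)
  rw [this]
  fun_prop

lemma norm_nodeFun_le {κ : ℝ} (hκ : 0 < κ) (p : ℤ × ℤ) (m : ℕ) (z : ℝ × ℝ) :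
    ‖T.nodeFun κ p m z‖ ≤ modeBound (2 * (κ * T.h₁)) (κ * T.h₂) := by
  have h1 := T.h₁_pos
  have h2 := T.h₂_pos
  rw [T.nodeFun_eq hκ, norm_mul, Complex.norm_real]
  have hX : ‖T.nodeX m (z.1 - (T.point p).1)‖ ≤ 1 := Real.abs_sin_le_one _
  have hY : ‖T.nodeY κ m (z.2 - (T.point p).2)‖ ≤ modeBound (2 * (κ * T.h₁)) (κ * T.h₂) := by
    have := norm_sin_div_sin_le (α := κ * (2 * T.h₁)) (β := κ * T.h₂) (n := 2 * m - 1)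
      (t := max 0 (T.h₂ - |z.2 - (T.point p).2|) * κ) (by positivity) (by positivity) (by
        rw [mul_comm]
        gcongr
        exact max_le h2.le (by linarith [abs_nonneg (z.2 - (T.point p).2)]))
    rw [nodeY, show 2 * (κ * T.h₁) = κ * (2 * T.h₁) by ring]
    rw [Complex.ofReal_mul κ, mul_comm (κ : ℂ)] at this
    exact this
  calc _ ≤ 1 * modeBound (2 * (κ * T.h₁)) (κ * T.h₂) := by gcongr
    _ = _ := one_mul _

/-- The node is the midpoint of the coarse side 2h₁, where the odd mode 2m + 1 has phase π/2 + mπ.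
-/
lemma nodeX_zero (m : ℕ) : T.nodeX (m + 1) 0 = (-1) ^ m := by
  have h1 := T.h₁_pos
  rw [T.nodeX_of_mem (by simpa using h1.le), show 2 * (m + 1) - 1 = 2 * m + 1 by omega]
  have : ((2 * m + 1 : ℕ) : ℝ) * Real.pi / (2 * T.h₁) * (T.h₁ + 0)
      = Real.pi / 2 + m * Real.pi := by
    push_cast
    field_simp
    ring
  rw [this, Real.sin_add_nat_mul_pi, Real.sin_pi_div_two, mul_one]

lemma nodeY_zero {κ : ℝ} (hκ : 0 < κ) (hres : κ ^ 2 ∉ neumannEigenvalues (2 * T.h₁) T.h₂)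
    (m : ℕ) : T.nodeY κ m 0 = 1 := by
  have h1 := T.h₁_pos
  have h2 := T.h₂_pos
  rw [nodeY, abs_zero, sub_zero, max_eq_right h2.le, Complex.ofReal_mul]
  exact div_self (sin_mul_modeRoot_ne_zero hκ (by positivity) h2 fun k hk => hres ⟨_, _, hk⟩)

lemma one_le_abs_sub_cast {i j : ℤ} (h : i ≠ j) : (1 : ℝ) ≤ |(i : ℝ) - j| := by
  have : 1 ≤ |i - j| := Int.one_le_abs (sub_ne_zero.2 h)
  exact_mod_cast this

/-- Distinct grid points are at least a full cell side apart in some coordinate, and the factor in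
that coordinate vanishes. This decouples the nodes in the collocation system. -/
lemma nodeFun_point {κ : ℝ} (hκ : 0 < κ)
    (hres : κ ^ 2 ∉ neumannEigenvalues (2 * T.h₁) T.h₂) (p q : ℤ × ℤ) (m : ℕ) :
    T.nodeFun κ p (m + 1) (T.point q) = if p = q then (-1) ^ m else 0 := by
  have h1 := T.h₁_pos
  have h2 := T.h₂_pos
  rw [T.nodeFun_eq hκ]
  split_ifs with h
  · subst h
    rw [sub_self, sub_self, T.nodeX_zero, T.nodeY_zero hκ hres]
    simp
  · by_cases hx : q.1 = p.1
    · have hy : q.2 ≠ p.2 := fun hy => h (Prod.ext hx.symm hy.symm)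
      rw [T.nodeY_of_le, mul_zero]
      have : (T.point q).2 - (T.point p).2 = ((q.2 : ℝ) - p.2) * T.h₂ := by
        simp only [point]
        ring
      rw [this, abs_mul, abs_of_pos h2]
      nlinarith [one_le_abs_sub_cast hy]
    · rw [T.nodeX_of_le, Complex.ofReal_zero, zero_mul]
      have : (T.point q).1 - (T.point p).1 = ((q.1 : ℝ) - p.1) * T.h₁ := by
        simp only [point]
        ring
      rw [this, abs_mul, abs_of_pos h1]
      nlinarith [one_le_abs_sub_cast hx]

/-! ### Derivatives of node functions -/

/-- The kinks of a node function in x lie on the grid lines at distance h₁ from its node, which open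
cells avoid. -/
lemma abs_sub_point_ne {c : ℤ × ℤ} {z : ℝ × ℝ} (hz : z ∈ T.cell c) (p : ℤ × ℤ) :
    |z.1 - (T.point p).1| ≠ T.h₁ := by
  have h1 := T.h₁_pos
  obtain ⟨⟨ha, hb⟩, -⟩ := hz
  simp only [point] at ha hb ⊢
  have key : ∀ e : ℤ, z.1 - (T.x₀ + p.1 * T.h₁) = e * T.h₁ → False := by
    intro e he
    have hc : ((c.1 : ℤ) : ℝ) < ((e + p.1 : ℤ) : ℝ) := by
      push_cast
      by_contra hcon
      push Not at hcon
      nlinarith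
    have hd : ((e + p.1 : ℤ) : ℝ) < ((c.1 + 1 : ℤ) : ℝ) := by
      push_cast
      by_contra hcon
      push Not at hcon
      nlinarith
    have hc' := Int.cast_lt.1 hc
    have hd' := Int.cast_lt.1 hd
    omega
  intro h
  rcases (abs_eq h1.le).1 h with h | h
  · exact key 1 (by simpa using h)
  · exact key (-1) (by simpa using h)

/-- The number `ν²` of the node function of index `m + 1`. -/
def nodeSq (κ : ℝ) (m : ℕ) : ℝ := ((2 * (m : ℝ) + 1) * (Real.pi / (2 * (κ * T.h₁)))) ^ 2

/-- Away from the kinks the x-factor is either a sine of frequency ω = κν or locally zero; in both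
cases its second derivative is -ω² times itself. -/
lemma scaledDerivX_nodeFun {κ : ℝ} (hκ : 0 < κ) (p : ℤ × ℤ) (m n : ℕ) {z : ℝ × ℝ}
    (hz : z ∈ T.cellUnion) :
    scaledDerivX κ (2 * n) (T.nodeFun κ p (m + 1)) z =
      (-(T.nodeSq κ m : ℂ)) ^ n * T.nodeFun κ p (m + 1) z := by
  have h1 := T.h₁_pos
  simp only [cellUnion, Set.mem_iUnion] at hz
  obtain ⟨c, -, hz⟩ := hz
  have hne := T.abs_sub_point_ne hz p
  set ω : ℝ := ((2 * (m + 1) - 1 : ℕ) : ℝ) * Real.pi / (2 * T.h₁) with hω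
  set xp := (T.point p).1
  set a := T.nodeY κ (m + 1) (z.2 - (T.point p).2)
  set U : Set ℝ := {t | |t - xp| ≠ T.h₁} with hUdef
  have hU : IsOpen U := isOpen_ne_fun (by fun_prop) (by fun_prop)
  have hf : (fun t => T.nodeFun κ p (m + 1) (t, z.2)) =
      fun t => (T.nodeX (m + 1) (t - xp) : ℂ) * a := by
    funext t
    rw [T.nodeFun_eq hκ]
  have hdd : ∀ t ∈ U, deriv (deriv fun t => (T.nodeX (m + 1) (t - xp) : ℂ) * a) t =
      -(ω : ℂ) ^ 2 * ((T.nodeX (m + 1) (t - xp) : ℂ) * a) := by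
    intro t ht
    rcases lt_or_gt_of_ne ht with hlt | hgt
    · have he : (fun t => (T.nodeX (m + 1) (t - xp) : ℂ) * a) =ᶠ[𝓝 t]
          fun t => (Real.sin (ω * ((T.h₁ - xp) + t)) : ℂ) * a := by
        have ho : IsOpen {t : ℝ | |t - xp| < T.h₁} := isOpen_lt (by fun_prop) (by fun_prop)
        filter_upwards [ho.mem_nhds hlt] with s hs
        rw [T.nodeX_of_mem (le_of_lt hs), sub_add_eq_add_sub, add_sub_assoc]
      rw [he.deriv.deriv_eq, deriv_deriv_sin_mul_const, he.eq_of_nhds]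
    · have he : (fun t => (T.nodeX (m + 1) (t - xp) : ℂ) * a) =ᶠ[𝓝 t] fun _ => 0 := by
        have ho : IsOpen {t : ℝ | T.h₁ < |t - xp|} := isOpen_lt (by fun_prop) (by fun_prop)
        filter_upwards [ho.mem_nhds hgt] with s hs
        rw [T.nodeX_of_le (le_of_lt hs)]
        simp
      rw [he.deriv.deriv_eq, he.eq_of_nhds]
      simp
  rw [scaledDerivX, partialX_iterate, hf, deriv_iterate_two_mul_eqOn hU hdd n z.1 hne,
    T.nodeFun_eq hκ, ← mul_assoc]
  congr 1
  rw [pow_mul, ← inv_pow, ← mul_pow]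
  congr 1
  have : ω ^ 2 = κ ^ 2 * T.nodeSq κ m := by
    rw [hω, nodeSq, show 2 * (m + 1) - 1 = 2 * m + 1 by omega]
    push_cast
    field_simp
  have hc : (ω : ℂ) ^ 2 = (κ : ℂ) ^ 2 * T.nodeSq κ m := by exact_mod_cast this
  have hκ' : (κ : ℂ) ≠ 0 := Complex.ofReal_ne_zero.2 hκ.ne'
  rw [hc]
  field_simp

/-! ### The collocation system -/

lemma closure_cell (c : ℤ × ℤ) : closure (T.cell c) =
    Set.Icc (T.point c).1 ((T.point c).1 + T.h₁) ×ˢ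
      Set.Icc (T.point c).2 ((T.point c).2 + T.h₂) := by
  have h1 := T.h₁_pos
  have h2 := T.h₂_pos
  rw [cell, closure_prod_eq, closure_Ioo (by linarith), closure_Ioo (by linarith)]

lemma cell_subset_cellUnion {c : ℤ × ℤ} (hc : c ∈ T.cells) : T.cell c ⊆ T.cellUnion :=
  Set.subset_biUnion_of_mem (u := fun c => T.cell c) hc

/-- The corners of a cell. -/
def corners (c : ℤ × ℤ) : Finset (ℤ × ℤ) :=
  {(c.1, c.2), (c.1 + 1, c.2), (c.1, c.2 + 1), (c.1 + 1, c.2 + 1)}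

lemma point_mem_closure_cell {c q : ℤ × ℤ} (hq : q ∈ corners c) :
    T.point q ∈ closure (T.cell c) := by
  have h1 := T.h₁_pos
  have h2 := T.h₂_pos
  rw [closure_cell]
  simp only [corners, mem_insert, mem_singleton] at hq
  rcases hq with rfl | rfl | rfl | rfl <;> simp only [point] <;> push_cast <;>
    refine ⟨⟨?_, ?_⟩, ?_, ?_⟩ <;> nlinarith

lemma point_mem_closure_cellUnion {q : ℤ × ℤ} (hq : q ∈ T.nodes) :
    T.point q ∈ closure T.cellUnion := by
  obtain ⟨c, hc, hq⟩ := mem_biUnion.1 hq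
  exact closure_mono (T.cell_subset_cellUnion hc) (T.point_mem_closure_cell hq)

/-- On the open cells the differentiated sum agrees with a continuous function, so its limit is the
value of that function at the node. Every node lies in the closure of the cells, so the limit is
unique. -/
lemma isCollocationSolution_iff {κ : ℝ} (hκ : 0 < κ)
    (hres : κ ^ 2 ∉ neumannEigenvalues (2 * T.h₁) T.h₂) (N : ℕ) (u : ℝ × ℝ → ℂ)
    (β : EuclideanSpace ℂ (T.nodes × Fin N)) :
    T.IsCollocationSolution κ N u β ↔ ∀ q : T.nodes, ∀ n : Fin N,
      ∑ m : Fin N, (-1) ^ (m : ℕ) * β (q, m) * (-(T.nodeSq κ m : ℂ)) ^ (n : ℕ) =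
        scaledDerivX κ (2 * n) u (T.point q) := by
  have key : ∀ q : T.nodes, ∀ n : ℕ, Filter.Tendsto
      (fun z => ∑ p : T.nodes, ∑ m : Fin N,
        β (p, m) * scaledDerivX κ (2 * n) (T.nodeFun κ p.1 (m.1 + 1)) z)
      (𝓝[T.cellUnion] (T.point q))
      (𝓝 (∑ m : Fin N, (-1) ^ (m : ℕ) * β (q, m) * (-(T.nodeSq κ m : ℂ)) ^ n)) := by
    intro q n
    have hval : ∑ p : T.nodes, ∑ m : Fin N,
        β (p, m) * ((-(T.nodeSq κ m : ℂ)) ^ n * T.nodeFun κ p.1 (m.1 + 1) (T.point q)) =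
        ∑ m : Fin N, (-1) ^ (m : ℕ) * β (q, m) * (-(T.nodeSq κ m : ℂ)) ^ n := by
      simp only [T.nodeFun_point hκ hres]
      rw [sum_eq_single q]
      · exact sum_congr rfl fun m _ => by rw [if_pos rfl]; ring
      · intro p _ hp
        exact sum_eq_zero fun m _ => by
          rw [if_neg fun h => hp (Subtype.ext h), mul_zero, mul_zero]
      · simp
    rw [← hval]
    have hcont : Continuous fun z => ∑ p : T.nodes, ∑ m : Fin N,
        β (p, m) * ((-(T.nodeSq κ m : ℂ)) ^ n * T.nodeFun κ p.1 (m.1 + 1) z) := by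
      refine continuous_finsetSum _ fun p _ => continuous_finsetSum _ fun m _ => ?_
      have := T.continuous_nodeFun hκ p.1 (m.1 + 1)
      fun_prop
    refine Filter.Tendsto.congr' ?_ (hcont.tendsto (T.point q) |>.mono_left nhdsWithin_le_nhds)
    filter_upwards [self_mem_nhdsWithin] with z hz
    exact sum_congr rfl fun p _ => sum_congr rfl fun m _ => by
      rw [T.scaledDerivX_nodeFun hκ _ _ _ hz]
  constructor
  · intro h q n
    have : (𝓝[T.cellUnion] (T.point q)).NeBot :=
      mem_closure_iff_nhdsWithin_neBot.1 (T.point_mem_closure_cellUnion q.2)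
    exact tendsto_nhds_unique (key q n) (h q q.2 n n.2)
  · intro h q hq n hn
    rw [← h ⟨q, hq⟩ ⟨n, hn⟩]
    exact key ⟨q, hq⟩ n

/-- Unique solvability of the collocation system, and a bound of its solution by the right-hand
side. -/
lemma exists_collocationSolution {α : ℝ} (hα : 0 < α) :
    ∃ B : ℝ, 0 < B ∧ ∀ (κ : ℝ), 0 < κ → ∀ T : Mesh, κ * T.h₁ = α →
      κ ^ 2 ∉ neumannEigenvalues (2 * T.h₁) T.h₂ → ∀ (u : ℝ × ℝ → ℂ) (N : ℕ),
      ∃ β : EuclideanSpace ℂ (T.nodes × Fin N), T.IsCollocationSolution κ N u β ∧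
        (∀ β' : EuclideanSpace ℂ (T.nodes × Fin N), T.IsCollocationSolution κ N u β' → β' = β) ∧
        ‖β‖ ^ 2 ≤ B ^ 2 * N *
          ∑ q ∈ T.nodes, ∑ n : Fin N, ‖scaledDerivX κ (2 * n) u (T.point q)‖ ^ 2 := by
  obtain ⟨B, hB0, hB⟩ := exists_prod_node_ratio_le (θ := Real.pi / (2 * α)) (by positivity)
  refine ⟨B, hB0, fun κ hκ T hκα hres u N => ?_⟩
  have hθ : 0 < Real.pi / (2 * α) := by positivity
  have hinj : Function.Injective fun k : Fin N => T.nodeSq κ k := by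
    intro k l hkl
    simp only [nodeSq, hκα] at hkl
    have h2 := (sq_eq_sq₀ (by positivity) (by positivity)).1 hkl
    have h3 := mul_right_cancel₀ hθ.ne' h2
    have h4 : ((k : ℕ) : ℝ) = (l : ℕ) := by linarith
    exact Fin.ext (by exact_mod_cast h4)
  obtain ⟨A, hA1, hA2⟩ := exists_vandermonde_left_inverse (fun k : Fin N => T.nodeSq κ k)
    (fun k => sq_nonneg _) hinj
  have hA1c : ∀ m k : Fin N, ∑ n : Fin N, (A m n : ℂ) * (-(T.nodeSq κ k : ℂ)) ^ (n : ℕ) =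
      if m = k then 1 else 0 := by
    intro m k
    have := congrArg (fun x : ℝ => (x : ℂ)) (hA1 m k)
    simp only [Complex.ofReal_sum, Complex.ofReal_mul, Complex.ofReal_pow,
      Complex.ofReal_neg] at this
    rw [this]
    split_ifs <;> simp
  set d : T.nodes → Fin N → ℂ := fun q n => scaledDerivX κ (2 * n) u (T.point q) with hd
  set γ : T.nodes → Fin N → ℂ := fun q m => ∑ n, (A m n : ℂ) * d q n with hγ
  have hsol : ∀ (q : T.nodes) (n : Fin N), ∑ m, γ q m * (-(T.nodeSq κ m : ℂ)) ^ (n : ℕ) = d q n := by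
    intro q n
    set V : Matrix (Fin N) (Fin N) ℂ := Matrix.of fun n k => (-(T.nodeSq κ k : ℂ)) ^ (n : ℕ)
    set A' : Matrix (Fin N) (Fin N) ℂ := Matrix.of fun m n => (A m n : ℂ)
    -- The left inverse yields uniqueness; for square matrices it is also a right inverse, which
    -- yields existence.
    have hAV : A' * V = 1 := by
      ext m k
      rw [Matrix.mul_apply, Matrix.one_apply]
      exact hA1c m k
    have hVA : V * A' = 1 := mul_eq_one_comm.1 hAV
    have h1 : V.mulVec (A'.mulVec (d q)) = d q := by
      rw [Matrix.mulVec_mulVec, hVA, Matrix.one_mulVec]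
    have h2 := congrFun h1 n
    rw [← h2]
    refine sum_congr rfl fun m _ => ?_
    exact mul_comm _ _
  have huniq : ∀ β' : EuclideanSpace ℂ (T.nodes × Fin N), T.IsCollocationSolution κ N u β' →
      ∀ (q : T.nodes) (m : Fin N), (-1) ^ (m : ℕ) * β' (q, m) = γ q m := by
    intro β' hβ' q m
    rw [T.isCollocationSolution_iff hκ hres] at hβ'
    simp only [hγ, hd, ← hβ' q, mul_sum]
    rw [sum_comm]
    have : ∀ k : Fin N, ∑ n : Fin N, (A m n : ℂ) *
        ((-1) ^ (k : ℕ) * β' (q, k) * (-(T.nodeSq κ k : ℂ)) ^ (n : ℕ)) =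
        (-1) ^ (k : ℕ) * β' (q, k) * if m = k then 1 else 0 := by
      intro k
      rw [← hA1c, mul_sum]
      exact sum_congr rfl fun n _ => by ring
    simp [this]
  have hsign : ∀ (m : ℕ) (x : ℂ), (-1) ^ m * ((-1) ^ m * x) = x := by
    intro m x
    rw [← mul_assoc, ← mul_pow]
    simp
  refine ⟨WithLp.toLp 2 fun i => (-1) ^ (i.2 : ℕ) * γ i.1 i.2, ?_, ?_, ?_⟩
  · rw [T.isCollocationSolution_iff hκ hres]
    intro q n
    simp only [hsign]
    exact hsol q n
  · intro β' hβ'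
    ext i
    have := huniq β' hβ' i.1 i.2
    change β' i = (-1) ^ (i.2 : ℕ) * γ i.1 i.2
    rw [← this, hsign]
  · rw [EuclideanSpace.norm_sq_eq, Fintype.sum_prod_type]
    simp only [norm_mul, norm_pow, norm_neg, norm_one, one_pow, one_mul]
    rw [← sum_coe_sort T.nodes, mul_sum]
    refine sum_le_sum fun q _ => ?_
    -- The ℓ² norm of a row is at most its ℓ¹ norm, hence at most B. The factor N then comes from
    -- summing this bound over the N rows.
    have hrow : ∀ m, ‖γ q m‖ ^ 2 ≤ B ^ 2 * ∑ n, ‖d q n‖ ^ 2 := by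
      intro m
      have hAB : ∑ n, |A m n| ≤ B := by
        refine (hA2 m).trans (le_trans (le_of_eq ?_) (hB N m))
        simp only [nodeSq, hκα]
      have hn : ‖γ q m‖ ≤ ∑ n, |A m n| * ‖d q n‖ := by
        refine (norm_sum_le _ _).trans (le_of_eq (sum_congr rfl fun n _ => ?_))
        rw [norm_mul, Complex.norm_real, Real.norm_eq_abs]
      calc ‖γ q m‖ ^ 2 ≤ (∑ n, |A m n| * ‖d q n‖) ^ 2 := by gcongr
        _ ≤ (∑ n, |A m n| ^ 2) * ∑ n, ‖d q n‖ ^ 2 := sum_mul_sq_le_sq_mul_sq _ _ _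
        _ ≤ (∑ n, |A m n|) ^ 2 * ∑ n, ‖d q n‖ ^ 2 := by
            gcongr
            exact sum_sq_le_sq_sum_of_nonneg fun _ _ => abs_nonneg _
        _ ≤ _ := by gcongr
    calc ∑ m, ‖γ q m‖ ^ 2 ≤ ∑ _m : Fin N, B ^ 2 * ∑ n, ‖d q n‖ ^ 2 :=
          sum_le_sum fun m _ => hrow m
      _ = _ := by
          rw [sum_const, card_univ, Fintype.card_fin, nsmul_eq_mul]
          ring

end Mesh

/-! ### Partial derivatives of analytic functions -/

lemma hasDerivAt_partialX {f : ℝ × ℝ → ℂ} {z : ℝ × ℝ} (hf : DifferentiableAt ℝ f z) :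
    HasDerivAt (fun t => f (t, z.2)) (fderiv ℝ f z (1, 0)) z.1 := by
  have h1 : HasDerivAt (fun t : ℝ => (t, z.2)) ((1 : ℝ), (0 : ℝ)) z.1 :=
    (hasDerivAt_id z.1).prodMk (hasDerivAt_const z.1 z.2)
  exact HasFDerivAt.comp_hasDerivAt (f := fun t : ℝ => (t, z.2)) z.1 hf.hasFDerivAt h1

lemma hasDerivAt_partialY {f : ℝ × ℝ → ℂ} {z : ℝ × ℝ} (hf : DifferentiableAt ℝ f z) :
    HasDerivAt (fun t => f (z.1, t)) (fderiv ℝ f z (0, 1)) z.2 := by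
  have h1 : HasDerivAt (fun t : ℝ => (z.1, t)) ((0 : ℝ), (1 : ℝ)) z.2 :=
    (hasDerivAt_const z.2 z.1).prodMk (hasDerivAt_id z.2)
  exact HasFDerivAt.comp_hasDerivAt (f := fun t : ℝ => (z.1, t)) z.2 hf.hasFDerivAt h1

lemma partialX_eventuallyEq_fderiv {f : ℝ × ℝ → ℂ} {z : ℝ × ℝ} (hf : AnalyticAt ℝ f z) :
    partialX f =ᶠ[𝓝 z] fun w => fderiv ℝ f w (1, 0) := by
  filter_upwards [hf.eventually_analyticAt] with w hw
  exact (hasDerivAt_partialX hw.differentiableAt).deriv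

lemma partialY_eventuallyEq_fderiv {f : ℝ × ℝ → ℂ} {z : ℝ × ℝ} (hf : AnalyticAt ℝ f z) :
    partialY f =ᶠ[𝓝 z] fun w => fderiv ℝ f w (0, 1) := by
  filter_upwards [hf.eventually_analyticAt] with w hw
  exact (hasDerivAt_partialY hw.differentiableAt).deriv

lemma _root_.AnalyticAt.partialX {f : ℝ × ℝ → ℂ} {z : ℝ × ℝ} (hf : AnalyticAt ℝ f z) :
    AnalyticAt ℝ (partialX f) z :=
  (((ContinuousLinearMap.apply ℝ ℂ ((1 : ℝ), (0 : ℝ))).analyticAt _).comp hf.fderiv).congr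
    (partialX_eventuallyEq_fderiv hf).symm

lemma _root_.AnalyticAt.partialY {f : ℝ × ℝ → ℂ} {z : ℝ × ℝ} (hf : AnalyticAt ℝ f z) :
    AnalyticAt ℝ (partialY f) z :=
  (((ContinuousLinearMap.apply ℝ ℂ ((0 : ℝ), (1 : ℝ))).analyticAt _).comp hf.fderiv).congr
    (partialY_eventuallyEq_fderiv hf).symm

lemma _root_.AnalyticAt.partialX_iterate {f : ℝ × ℝ → ℂ} {z : ℝ × ℝ} (hf : AnalyticAt ℝ f z)
    (k : ℕ) : AnalyticAt ℝ (Trefftz.partialX^[k] f) z := by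
  induction k with
  | zero => exact hf
  | succ k ih =>
    rw [Function.iterate_succ_apply']
    exact ih.partialX

lemma partialX_congr {f g : ℝ × ℝ → ℂ} {z : ℝ × ℝ} (h : f =ᶠ[𝓝 z] g) :
    partialX f =ᶠ[𝓝 z] partialX g := by
  filter_upwards [eventually_eventually_nhds.2 h] with w hw
  have hc : Filter.Tendsto (fun t : ℝ => (t, w.2)) (𝓝 w.1) (𝓝 w) :=
    Continuous.tendsto' (by fun_prop) _ _ rfl
  exact Filter.EventuallyEq.deriv_eq (hc.eventually hw)

lemma partialX_iterate_congr {f g : ℝ × ℝ → ℂ} {z : ℝ × ℝ} (h : f =ᶠ[𝓝 z] g) (k : ℕ) :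
    partialX^[k] f =ᶠ[𝓝 z] partialX^[k] g := by
  induction k with
  | zero => exact h
  | succ k ih =>
    rw [Function.iterate_succ_apply', Function.iterate_succ_apply']
    exact partialX_congr ih

lemma partialY_partialX {f : ℝ × ℝ → ℂ} {z : ℝ × ℝ} (hf : AnalyticAt ℝ f z) :
    partialY (partialX f) z = partialX (partialY f) z := by
  have hsymm : IsSymmSndFDerivAt ℝ f z :=
    hf.contDiffAt.isSymmSndFDerivAt (n := 2) (by simp)
  have hd : DifferentiableAt ℝ (fderiv ℝ f) z := hf.fderiv.differentiableAt
  have hv : ∀ v w : ℝ × ℝ, fderiv ℝ (fun x => fderiv ℝ f x v) z w = fderiv ℝ (fderiv ℝ f) z w v := by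
    intro v w
    rw [fderiv_clm_apply hd (differentiableAt_const _)]
    simp
  have h1 : partialY (partialX f) z = fderiv ℝ (fun x => fderiv ℝ f x (1, 0)) z (0, 1) := by
    rw [← (partialX_eventuallyEq_fderiv hf).fderiv_eq]
    exact (hasDerivAt_partialY hf.partialX.differentiableAt).deriv
  have h2 : partialX (partialY f) z = fderiv ℝ (fun x => fderiv ℝ f x (0, 1)) z (1, 0) := by
    rw [← (partialY_eventuallyEq_fderiv hf).fderiv_eq]
    exact (hasDerivAt_partialX hf.partialY.differentiableAt).deriv
  rw [h1, h2, hv, hv]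
  exact hsymm.eq _ _

/-- The cell embedding produces ∂₂∂₁ᵏu, whereas the Sobolev norm is written with ∂₁ᵏ∂₂u. -/
lemma partialY_partialX_iterate {f : ℝ × ℝ → ℂ} {z : ℝ × ℝ} (hf : AnalyticAt ℝ f z) (k : ℕ) :
    partialY (partialX^[k] f) z = (partialX^[k] (partialY f)) z := by
  induction k generalizing f with
  | zero => rfl
  | succ k ih =>
    rw [Function.iterate_succ_apply, ih hf.partialX, Function.iterate_succ_apply]
    refine (partialX_iterate_congr ?_ k).eq_of_nhds
    filter_upwards [hf.eventually_analyticAt] with w hw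
    exact partialY_partialX hw

/-! ### Traces on a rectangle -/

/-- The one-dimensional Sobolev inequality on each vertical segment, integrated over x by Fubini. -/
lemma trace_horizontal {a b c d : ℝ} (hcd : c < d) {f : ℝ × ℝ → ℂ}
    (hf : AnalyticOnNhd ℝ f (Set.Icc a b ×ˢ Set.Icc c d)) {y : ℝ} (hy : y ∈ Set.Icc c d) :
    ∫ x in Set.Ioo a b, ‖f (x, y)‖ ^ 2 ≤
      2 / (d - c) * (∫ z in Set.Ioo a b ×ˢ Set.Ioo c d, ‖f z‖ ^ 2) +
      2 * (d - c) * ∫ z in Set.Ioo a b ×ˢ Set.Ioo c d, ‖partialY f z‖ ^ 2 := by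
  have hint : ∀ g : ℝ × ℝ → ℂ, AnalyticOnNhd ℝ g (Set.Icc a b ×ˢ Set.Icc c d) →
      IntegrableOn (fun z => ‖g z‖ ^ 2) (Set.Ioo a b ×ˢ Set.Ioo c d)
        ((volume : Measure ℝ).prod volume) := by
    intro g hg
    have h1 : IntegrableOn (fun z => ‖g z‖ ^ 2) (Set.Icc a b ×ˢ Set.Icc c d)
        ((volume : Measure ℝ).prod volume) :=
      (hg.continuousOn.norm.pow 2).integrableOn_compact (isCompact_Icc.prod isCompact_Icc)
    exact h1.mono_set (Set.prod_mono Set.Ioo_subset_Icc_self Set.Ioo_subset_Icc_self)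
  have hleft : ∀ g : ℝ × ℝ → ℂ, AnalyticOnNhd ℝ g (Set.Icc a b ×ˢ Set.Icc c d) →
      IntegrableOn (fun x => ∫ y in Set.Ioo c d, ‖g (x, y)‖ ^ 2) (Set.Ioo a b) := by
    intro g hg
    have h1 := hint g hg
    rw [IntegrableOn, ← Measure.prod_restrict] at h1
    exact h1.integral_prod_left
  have hfy : AnalyticOnNhd ℝ (partialY f) (Set.Icc a b ×ˢ Set.Icc c d) :=
    fun z hz => (hf z hz).partialY
  rw [Measure.volume_eq_prod, setIntegral_prod _ (hint f hf), setIntegral_prod _ (hint _ hfy),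
    ← integral_const_mul, ← integral_const_mul, ← integral_add
      ((hleft f hf).const_mul _) ((hleft _ hfy).const_mul _)]
  refine setIntegral_mono_on ?_ (((hleft f hf).const_mul _).add ((hleft _ hfy).const_mul _))
    measurableSet_Ioo fun x hx => ?_
  · have hc : ContinuousOn (fun x => ‖f (x, y)‖ ^ 2) (Set.Icc a b) :=
      (hf.continuousOn.comp (f := fun x : ℝ => (x, y)) (by fun_prop)
        (fun x hx => ⟨hx, hy⟩)).norm.pow 2
    exact hc.integrableOn_Icc.mono_set Set.Ioo_subset_Icc_self
  · have hx' := Set.Ioo_subset_Icc_self hx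
    have hmaps : Set.MapsTo (fun t : ℝ => (x, t)) (Set.Icc c d)
        (Set.Icc a b ×ˢ Set.Icc c d) := fun t ht => ⟨hx', ht⟩
    have h := norm_sq_le_integral hcd (f := fun t => f (x, t)) (f' := fun t => partialY f (x, t))
      (fun t ht => by
        have h := hasDerivAt_partialY (hf (x, t) ⟨hx', ht⟩).differentiableAt
        have h' : partialY f (x, t) = fderiv ℝ f (x, t) (0, 1) := h.deriv
        rw [h']
        exact h)
      (hfy.continuousOn.comp (by fun_prop) hmaps) hy
    rwa [intervalIntegral.integral_of_le hcd.le, intervalIntegral.integral_of_le hcd.le,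
      integral_Ioc_eq_integral_Ioo, integral_Ioc_eq_integral_Ioo] at h

lemma trace_vertical {a b c d : ℝ} (hab : a < b) {f : ℝ × ℝ → ℂ}
    (hf : AnalyticOnNhd ℝ f (Set.Icc a b ×ˢ Set.Icc c d)) {x : ℝ} (hx : x ∈ Set.Icc a b) :
    ∫ y in Set.Ioo c d, ‖f (x, y)‖ ^ 2 ≤
      2 / (b - a) * (∫ z in Set.Ioo a b ×ˢ Set.Ioo c d, ‖f z‖ ^ 2) +
      2 * (b - a) * ∫ z in Set.Ioo a b ×ˢ Set.Ioo c d, ‖partialX f z‖ ^ 2 := by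
  have hswap : AnalyticOnNhd ℝ (fun z : ℝ × ℝ => f z.swap) (Set.Icc c d ×ˢ Set.Icc a b) := by
    intro z hz
    have h1 : AnalyticAt ℝ (fun z : ℝ × ℝ => (z.2, z.1)) z := analyticAt_snd.prod analyticAt_fst
    exact AnalyticAt.comp (f := fun z : ℝ × ℝ => (z.2, z.1)) (hf (z.2, z.1) ⟨hz.2, hz.1⟩) h1
  have h := trace_horizontal hab hswap hx
  have e1 := setIntegral_prod_swap (μ := (volume : Measure ℝ)) (ν := (volume : Measure ℝ))
    (Set.Ioo a b) (Set.Ioo c d) fun z => ‖f z‖ ^ 2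
  have e2 := setIntegral_prod_swap (μ := (volume : Measure ℝ)) (ν := (volume : Measure ℝ))
    (Set.Ioo a b) (Set.Ioo c d) fun z => ‖partialX f z‖ ^ 2
  rw [← Measure.volume_eq_prod] at e1 e2
  rw [e1] at h
  rw [← e2]
  exact h

/-- The one-dimensional inequality along the horizontal segment through z, followed by the trace
inequality for f and for ∂₁f; the latter brings in the mixed derivative. -/
lemma norm_sq_le_integral_rectangle {a b c d : ℝ} (hab : a < b) (hcd : c < d) {f : ℝ × ℝ → ℂ}
    (hf : AnalyticOnNhd ℝ f (Set.Icc a b ×ˢ Set.Icc c d)) {z : ℝ × ℝ}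
    (hz : z ∈ Set.Icc a b ×ˢ Set.Icc c d) :
    ‖f z‖ ^ 2 ≤ 4 / ((b - a) * (d - c)) *
      ((∫ z in Set.Ioo a b ×ˢ Set.Ioo c d, ‖f z‖ ^ 2) +
        (d - c) ^ 2 * (∫ z in Set.Ioo a b ×ˢ Set.Ioo c d, ‖partialY f z‖ ^ 2) +
        (b - a) ^ 2 * (∫ z in Set.Ioo a b ×ˢ Set.Ioo c d, ‖partialX f z‖ ^ 2) +
        (b - a) ^ 2 * (d - c) ^ 2 *
          ∫ z in Set.Ioo a b ×ˢ Set.Ioo c d, ‖partialY (partialX f) z‖ ^ 2) := by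
  have hba : 0 < b - a := sub_pos.2 hab
  have hdc : 0 < d - c := sub_pos.2 hcd
  have hfx : AnalyticOnNhd ℝ (partialX f) (Set.Icc a b ×ˢ Set.Icc c d) :=
    fun z hz => (hf z hz).partialX
  have hmaps : Set.MapsTo (fun t : ℝ => (t, z.2)) (Set.Icc a b)
      (Set.Icc a b ×ˢ Set.Icc c d) := fun t ht => ⟨ht, hz.2⟩
  have h := norm_sq_le_integral hab (f := fun t => f (t, z.2))
    (f' := fun t => partialX f (t, z.2))
    (fun t ht => by
      have h := hasDerivAt_partialX (hf (t, z.2) ⟨ht, hz.2⟩).differentiableAt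
      have h' : partialX f (t, z.2) = fderiv ℝ f (t, z.2) (1, 0) := h.deriv
      rw [h']
      exact h)
    (hfx.continuousOn.comp (by fun_prop) hmaps) hz.1
  rw [intervalIntegral.integral_of_le hab.le, intervalIntegral.integral_of_le hab.le,
    integral_Ioc_eq_integral_Ioo, integral_Ioc_eq_integral_Ioo] at h
  refine h.trans ((add_le_add
    (mul_le_mul_of_nonneg_left (trace_horizontal hcd hf hz.2) (by positivity))
    (mul_le_mul_of_nonneg_left (trace_horizontal hcd hfx hz.2) (by positivity))).trans
    (le_of_eq ?_))
  field_simp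
  ring

namespace Mesh

variable (T : Mesh)

/-! ### From cells to the domain -/

lemma cell_subset_domain {c : ℤ × ℤ} (hc : c ∈ T.cells) : T.cell c ⊆ T.domain := by
  have ho : IsOpen (T.cell c) := isOpen_Ioo.prod isOpen_Ioo
  refine interior_maximal ?_ ho
  exact subset_closure.trans (Set.subset_biUnion_of_mem (u := fun c => closure (T.cell c)) hc)

lemma closure_cell_subset {c : ℤ × ℤ} (hc : c ∈ T.cells) :
    closure (T.cell c) ⊆ closure T.domain := closure_mono (T.cell_subset_domain hc)

lemma isCompact_closure_domain : IsCompact (closure T.domain) := by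
  have h : IsCompact (⋃ c ∈ T.cells, closure (T.cell c)) :=
    T.cells.isCompact_biUnion fun c _ => by
      rw [closure_cell]
      exact isCompact_Icc.prod isCompact_Icc
  exact h.of_isClosed_subset isClosed_closure (closure_minimal interior_subset h.isClosed)

lemma disjoint_cell {c c' : ℤ × ℤ} (h : c ≠ c') : Disjoint (T.cell c) (T.cell c') := by
  have h1 := T.h₁_pos
  have h2 := T.h₂_pos
  rw [Set.disjoint_left]
  rintro z ⟨⟨a1, a2⟩, a3, a4⟩ ⟨⟨b1, b2⟩, b3, b4⟩
  simp only [point] at *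
  have key : ∀ {i j : ℤ} {t o l : ℝ}, 0 < l → o + i * l < t → t < o + i * l + l →
      o + j * l < t → t < o + j * l + l → i = j := by
    intro i j t o l hl p1 p2 p3 p4
    have q1 : (i : ℝ) < ((j + 1 : ℤ) : ℝ) := by
      push_cast
      by_contra hcon
      push Not at hcon
      nlinarith
    have q2 : (j : ℝ) < ((i + 1 : ℤ) : ℝ) := by
      push_cast
      by_contra hcon
      push Not at hcon
      nlinarith
    have q1' := Int.cast_lt.1 q1
    have q2' := Int.cast_lt.1 q2
    omega
  exact h (Prod.ext (key h1 a1 a2 b1 b2) (key h2 a3 a4 b3 b4))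

lemma sum_integral_cell_le {f : ℝ × ℝ → ℂ} (hf : AnalyticOnNhd ℝ f (closure T.domain)) :
    ∑ c ∈ T.cells, ∫ z in T.cell c, ‖f z‖ ^ 2 ≤ ∫ z in T.domain, ‖f z‖ ^ 2 := by
  have hint : IntegrableOn (fun z => ‖f z‖ ^ 2) T.domain :=
    ((hf.continuousOn.norm.pow 2).integrableOn_compact T.isCompact_closure_domain).mono_set
      subset_closure
  have hmeas : ∀ c, MeasurableSet (T.cell c) := fun c => measurableSet_Ioo.prod measurableSet_Ioo
  rw [← integral_biUnion_finset T.cells (fun c _ => hmeas c)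
    (fun c _ c' _ h => T.disjoint_cell h)
    (fun c hc => hint.mono_set (T.cell_subset_domain hc))]
  exact setIntegral_mono_set hint (Filter.Eventually.of_forall fun _ => by positivity)
    (LE.le.eventuallyLE (Set.iUnion₂_subset fun c hc => T.cell_subset_domain hc))

/-- Nodes and edges shared by several cells are merely counted more often on the right. -/
lemma sum_biUnion_le {ι ι' : Type*} [DecidableEq ι'] (s : Finset ι) (t : ι → Finset ι')
    {f : ι' → ℝ} (hf : ∀ i, 0 ≤ f i) : ∑ i ∈ s.biUnion t, f i ≤ ∑ c ∈ s, ∑ i ∈ t c, f i := by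
  classical
  induction s using Finset.induction_on with
  | empty => simp
  | insert a s ha ih =>
    rw [biUnion_insert, sum_insert ha]
    have := sum_union_inter (s₁ := t a) (s₂ := s.biUnion t) (f := f)
    have h0 : 0 ≤ ∑ i ∈ t a ∩ s.biUnion t, f i := sum_nonneg fun i _ => hf i
    linarith

/-- The discrete Sobolev embedding: sums of squares of nodal values. -/
lemma sum_nodes_norm_sq_le {f : ℝ × ℝ → ℂ} (hf : AnalyticOnNhd ℝ f (closure T.domain)) :
    ∑ q ∈ T.nodes, ‖f (T.point q)‖ ^ 2 ≤ 16 / (T.h₁ * T.h₂) *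
      ((∫ z in T.domain, ‖f z‖ ^ 2) + T.h₂ ^ 2 * (∫ z in T.domain, ‖partialY f z‖ ^ 2) +
        T.h₁ ^ 2 * (∫ z in T.domain, ‖partialX f z‖ ^ 2) +
        T.h₁ ^ 2 * T.h₂ ^ 2 * ∫ z in T.domain, ‖partialY (partialX f) z‖ ^ 2) := by
  have h1 := T.h₁_pos
  have h2 := T.h₂_pos
  set G : (ℝ × ℝ → ℂ) → ℤ × ℤ → ℝ := fun g c => ∫ z in T.cell c, ‖g z‖ ^ 2 with hG
  have hcell : ∀ c ∈ T.cells, ∀ q ∈ corners c, ‖f (T.point q)‖ ^ 2 ≤ 4 / (T.h₁ * T.h₂) *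
      (G f c + T.h₂ ^ 2 * G (partialY f) c + T.h₁ ^ 2 * G (partialX f) c +
        T.h₁ ^ 2 * T.h₂ ^ 2 * G (partialY (partialX f)) c) := by
    intro c hc q hq
    have hz := T.point_mem_closure_cell hq
    have hfc := hf.mono (T.closure_cell_subset hc)
    rw [closure_cell] at hz hfc
    have := norm_sq_le_integral_rectangle (by linarith) (by linarith) hfc hz
    simp only [add_sub_cancel_left] at this
    exact this
  have hsum : ∀ c ∈ T.cells, ∑ q ∈ corners c, ‖f (T.point q)‖ ^ 2 ≤ 16 / (T.h₁ * T.h₂) *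
      (G f c + T.h₂ ^ 2 * G (partialY f) c + T.h₁ ^ 2 * G (partialX f) c +
        T.h₁ ^ 2 * T.h₂ ^ 2 * G (partialY (partialX f)) c) := by
    intro c hc
    have hnn : ∀ g, 0 ≤ G g c := fun g => integral_nonneg fun _ => by positivity
    have n1 := hnn f
    have n2 := hnn (partialY f)
    have n3 := hnn (partialX f)
    have n4 := hnn (partialY (partialX f))
    refine (sum_le_card_nsmul _ _ _ (hcell c hc)).trans ?_
    -- Four corners times the constant 4 of the embedding give 16.
    have hcard : ((corners c).card : ℝ) ≤ 4 := by exact_mod_cast card_le_four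
    rw [nsmul_eq_mul]
    calc _ ≤ 4 * (4 / (T.h₁ * T.h₂) * (G f c + T.h₂ ^ 2 * G (partialY f) c +
          T.h₁ ^ 2 * G (partialX f) c + T.h₁ ^ 2 * T.h₂ ^ 2 * G (partialY (partialX f)) c)) := by
          gcongr
      _ = _ := by ring
  refine (sum_biUnion_le T.cells corners fun q => by positivity).trans
    ((sum_le_sum hsum).trans ?_)
  rw [← mul_sum, sum_add_distrib, sum_add_distrib, sum_add_distrib, ← mul_sum, ← mul_sum,
    ← mul_sum]
  have e1 := T.sum_integral_cell_le hf
  have e2 := T.sum_integral_cell_le (f := partialY f) fun z hz => (hf z hz).partialY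
  have e3 := T.sum_integral_cell_le (f := partialX f) fun z hz => (hf z hz).partialX
  have e4 := T.sum_integral_cell_le (f := partialY (partialX f))
    fun z hz => (hf z hz).partialX.partialY
  gcongr

/-- Every edge is charged to the cells it bounds. A cell has two horizontal edges, each costing 2/h₂
in the trace inequality. -/
lemma sum_horizontalEdges_le {f : ℝ × ℝ → ℂ} (hf : AnalyticOnNhd ℝ f (closure T.domain)) :
    ∑ p ∈ T.horizontalEdges, ∫ t in (0 : ℝ)..T.h₁, ‖f (T.edgeParam (Sum.inl p) t)‖ ^ 2 ≤
      4 / T.h₂ * ((∫ z in T.domain, ‖f z‖ ^ 2) +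
        T.h₂ ^ 2 * ∫ z in T.domain, ‖partialY f z‖ ^ 2) := by
  have h1 := T.h₁_pos
  have h2 := T.h₂_pos
  set G : (ℝ × ℝ → ℂ) → ℤ × ℤ → ℝ := fun g c => ∫ z in T.cell c, ‖g z‖ ^ 2 with hG
  have hcell : ∀ c ∈ T.cells, ∀ p ∈ ({(c.1, c.2), (c.1, c.2 + 1)} : Finset (ℤ × ℤ)),
      ∫ t in (0 : ℝ)..T.h₁, ‖f (T.edgeParam (Sum.inl p) t)‖ ^ 2 ≤
      2 / T.h₂ * (G f c + T.h₂ ^ 2 * G (partialY f) c) := by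
    intro c hc p hp
    have hfc := hf.mono (T.closure_cell_subset hc)
    rw [closure_cell] at hfc
    have hp1 : (T.point p).1 = (T.point c).1 := by
      simp only [mem_insert, mem_singleton] at hp
      rcases hp with rfl | rfl <;> rfl
    have hp2 : (T.point p).2 ∈ Set.Icc (T.point c).2 ((T.point c).2 + T.h₂) := by
      simp only [mem_insert, mem_singleton] at hp
      rcases hp with rfl | rfl <;> simp only [point] <;> push_cast <;> constructor <;> nlinarith
    have := trace_horizontal (by linarith) hfc hp2
    rw [← integral_Ioc_eq_integral_Ioo, ← intervalIntegral.integral_of_le (by linarith),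
      add_sub_cancel_left] at this
    have e : ∫ t in (0 : ℝ)..T.h₁, ‖f (T.edgeParam (Sum.inl p) t)‖ ^ 2 =
        ∫ x in (T.point c).1..((T.point c).1 + T.h₁), ‖f (x, (T.point p).2)‖ ^ 2 := by
      have := intervalIntegral.integral_comp_add_left
        (fun x => ‖f (x, (T.point p).2)‖ ^ 2) (T.point c).1 (a := 0) (b := T.h₁)
      rw [add_zero] at this
      rw [← this, ← hp1]
      rfl
    rw [e]
    refine this.trans (le_of_eq ?_)
    simp only [hG, cell]
    field_simp
  refine (sum_biUnion_le T.cells _ fun p =>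
    intervalIntegral.integral_nonneg h1.le fun _ _ => by positivity).trans ?_
  have hsum : ∀ c ∈ T.cells, ∑ p ∈ ({(c.1, c.2), (c.1, c.2 + 1)} : Finset (ℤ × ℤ)),
      ∫ t in (0 : ℝ)..T.h₁, ‖f (T.edgeParam (Sum.inl p) t)‖ ^ 2 ≤
      4 / T.h₂ * (G f c + T.h₂ ^ 2 * G (partialY f) c) := by
    intro c hc
    have hnn : ∀ g, 0 ≤ G g c := fun g => integral_nonneg fun _ => by positivity
    have n1 := hnn f
    have n2 := hnn (partialY f)
    refine (sum_le_card_nsmul _ _ _ (hcell c hc)).trans ?_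
    rw [nsmul_eq_mul]
    have hcard : ((({(c.1, c.2), (c.1, c.2 + 1)} : Finset (ℤ × ℤ)).card : ℕ) : ℝ) ≤ 2 := by
      exact_mod_cast card_le_two
    calc _ ≤ 2 * (2 / T.h₂ * (G f c + T.h₂ ^ 2 * G (partialY f) c)) := by gcongr
      _ = _ := by ring
  refine (sum_le_sum hsum).trans ?_
  rw [← mul_sum, sum_add_distrib, ← mul_sum]
  have e1 := T.sum_integral_cell_le hf
  have e2 := T.sum_integral_cell_le (f := partialY f) fun z hz => (hf z hz).partialY
  gcongr

lemma sum_verticalEdges_le {f : ℝ × ℝ → ℂ} (hf : AnalyticOnNhd ℝ f (closure T.domain)) :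
    ∑ p ∈ T.verticalEdges, ∫ t in (0 : ℝ)..T.h₂, ‖f (T.edgeParam (Sum.inr p) t)‖ ^ 2 ≤
      4 / T.h₁ * ((∫ z in T.domain, ‖f z‖ ^ 2) +
        T.h₁ ^ 2 * ∫ z in T.domain, ‖partialX f z‖ ^ 2) := by
  have h1 := T.h₁_pos
  have h2 := T.h₂_pos
  set G : (ℝ × ℝ → ℂ) → ℤ × ℤ → ℝ := fun g c => ∫ z in T.cell c, ‖g z‖ ^ 2 with hG
  have hcell : ∀ c ∈ T.cells, ∀ p ∈ ({(c.1, c.2), (c.1 + 1, c.2)} : Finset (ℤ × ℤ)),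
      ∫ t in (0 : ℝ)..T.h₂, ‖f (T.edgeParam (Sum.inr p) t)‖ ^ 2 ≤
      2 / T.h₁ * (G f c + T.h₁ ^ 2 * G (partialX f) c) := by
    intro c hc p hp
    have hfc := hf.mono (T.closure_cell_subset hc)
    rw [closure_cell] at hfc
    have hp1 : (T.point p).2 = (T.point c).2 := by
      simp only [mem_insert, mem_singleton] at hp
      rcases hp with rfl | rfl <;> rfl
    have hp2 : (T.point p).1 ∈ Set.Icc (T.point c).1 ((T.point c).1 + T.h₁) := by
      simp only [mem_insert, mem_singleton] at hp
      rcases hp with rfl | rfl <;> simp only [point] <;> push_cast <;> constructor <;> nlinarith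
    have := trace_vertical (by linarith) hfc hp2
    rw [← integral_Ioc_eq_integral_Ioo, ← intervalIntegral.integral_of_le (by linarith),
      add_sub_cancel_left] at this
    have e : ∫ t in (0 : ℝ)..T.h₂, ‖f (T.edgeParam (Sum.inr p) t)‖ ^ 2 =
        ∫ y in (T.point c).2..((T.point c).2 + T.h₂), ‖f ((T.point p).1, y)‖ ^ 2 := by
      have := intervalIntegral.integral_comp_add_left
        (fun y => ‖f ((T.point p).1, y)‖ ^ 2) (T.point c).2 (a := 0) (b := T.h₂)
      rw [add_zero] at this
      rw [← this, ← hp1]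
      rfl
    rw [e]
    refine this.trans (le_of_eq ?_)
    simp only [hG, cell]
    field_simp
  refine (sum_biUnion_le T.cells _ fun p =>
    intervalIntegral.integral_nonneg h2.le fun _ _ => by positivity).trans ?_
  have hsum : ∀ c ∈ T.cells, ∑ p ∈ ({(c.1, c.2), (c.1 + 1, c.2)} : Finset (ℤ × ℤ)),
      ∫ t in (0 : ℝ)..T.h₂, ‖f (T.edgeParam (Sum.inr p) t)‖ ^ 2 ≤
      4 / T.h₁ * (G f c + T.h₁ ^ 2 * G (partialX f) c) := by
    intro c hc
    have hnn : ∀ g, 0 ≤ G g c := fun g => integral_nonneg fun _ => by positivity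
    have n1 := hnn f
    have n2 := hnn (partialX f)
    refine (sum_le_card_nsmul _ _ _ (hcell c hc)).trans ?_
    rw [nsmul_eq_mul]
    have hcard : ((({(c.1, c.2), (c.1 + 1, c.2)} : Finset (ℤ × ℤ)).card : ℕ) : ℝ) ≤ 2 := by
      exact_mod_cast card_le_two
    calc _ ≤ 2 * (2 / T.h₁ * (G f c + T.h₁ ^ 2 * G (partialX f) c)) := by gcongr
      _ = _ := by ring
  refine (sum_le_sum hsum).trans ?_
  rw [← mul_sum, sum_add_distrib, ← mul_sum]
  have e1 := T.sum_integral_cell_le hf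
  have e2 := T.sum_integral_cell_le (f := partialX f) fun z hz => (hf z hz).partialX
  gcongr

/-! ### Edge coefficients -/

lemma edgeLength_pos (s : (ℤ × ℤ) ⊕ (ℤ × ℤ)) : 0 < T.edgeLength s := by
  cases s
  · exact T.h₁_pos
  · exact T.h₂_pos

lemma continuous_edgeParam (s : (ℤ × ℤ) ⊕ (ℤ × ℤ)) : Continuous (T.edgeParam s) := by
  cases s
  · exact (continuous_const.add continuous_id).prodMk continuous_const
  · exact continuous_const.prodMk (continuous_const.add continuous_id)

/-- On the edge the transversal factor is a quotient of equal sines, which is 1 because the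
resonance condition keeps the denominator from vanishing. -/
lemma edgeFun_edgeParam {κ : ℝ} (hκ : 0 < κ)
    (hres : κ ^ 2 ∉ neumannEigenvalues (2 * T.h₁) T.h₂) (s : (ℤ × ℤ) ⊕ (ℤ × ℤ)) (n : ℕ) {t : ℝ}
    (ht : t ∈ Set.Icc 0 (T.edgeLength s)) :
    T.edgeFun κ s n (T.edgeParam s t) = (Real.sin (n * Real.pi / T.edgeLength s * t) : ℂ) := by
  have h1 := T.h₁_pos
  have h2 := T.h₂_pos
  cases s with
  | inl p =>
    simp only [edgeLength] at ht ⊢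
    have hmem : T.edgeParam (Sum.inl p) t ∈ Set.Icc (T.point p).1 ((T.point p).1 + T.h₁) ×ˢ
        Set.Icc (T.point p).2 ((T.point p).2 + T.h₂) := by
      simp only [edgeParam]
      exact ⟨⟨by linarith [ht.1], by linarith [ht.2]⟩, le_rfl, by linarith⟩
    simp only [edgeFun, if_pos hmem]
    simp only [edgeParam]
    rw [mode_eq_real_sin hκ, add_sub_cancel_left, sub_self, add_zero, div_self, mul_one]
    -- An eigenvalue of the h₁ × h₂ cell with indices (n, k) is one of the 2h₁ × h₂ rectangle with
    -- indices (2n, k).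
    refine sin_mul_modeRoot_ne_zero hκ h1 h2 fun k hk => hres ⟨2 * n, k, ?_⟩
    rw [hk]
    push_cast
    field_simp
  | inr p =>
    simp only [edgeLength] at ht ⊢
    have hmem : T.edgeParam (Sum.inr p) t ∈ Set.Icc (T.point p).1 ((T.point p).1 + T.h₁) ×ˢ
        Set.Icc (T.point p).2 ((T.point p).2 + T.h₂) := by
      simp only [edgeParam]
      exact ⟨⟨le_rfl, by linarith⟩, by linarith [ht.1], by linarith [ht.2]⟩
    simp only [edgeFun, if_pos hmem]
    simp only [edgeParam]
    rw [mode_eq_real_sin hκ, add_sub_cancel_left, sub_self, add_zero, div_self, mul_one]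
    refine sin_mul_modeRoot_ne_zero hκ h2 h1 fun k hk => hres ⟨2 * k, n, ?_⟩
    rw [hk]
    push_cast
    field_simp
    ring

/-- The traces of the edge functions are sines of squared norm L/2, so this is Bessel's inequality,
with a bound independent of N. -/
lemma sum_edgeCoefficients_le {κ : ℝ} (hκ : 0 < κ)
    (hres : κ ^ 2 ∉ neumannEigenvalues (2 * T.h₁) T.h₂) (s : T.edges) (N : ℕ) {w : ℝ × ℝ → ℂ}
    (hw : ContinuousOn (fun t => w (T.edgeParam s t)) (Set.Icc 0 (T.edgeLength s))) :
    ∑ n : Fin N, ‖T.edgeCoefficients κ N w (s, n)‖ ^ 2 ≤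
      2 / T.edgeLength s * ∫ t in (0 : ℝ)..T.edgeLength s, ‖w (T.edgeParam s t)‖ ^ 2 := by
  have hL := T.edgeLength_pos s
  refine le_trans (le_of_eq (sum_congr rfl fun n _ => ?_)) (sine_bessel hL hw N)
  have hin : T.edgeInner s w (T.edgeFun κ s (n + 1)) = ∫ t in (0 : ℝ)..T.edgeLength s,
      w (T.edgeParam s t) *
        (Real.sin (((n : ℕ) + 1 : ℕ) * Real.pi / T.edgeLength s * t) : ℂ) := by
    refine intervalIntegral.integral_congr fun t ht => ?_
    rw [Set.uIcc_of_le hL.le] at ht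
    rw [T.edgeFun_edgeParam hκ hres _ _ ht, Complex.conj_ofReal]
  have hnorm : T.edgeNormSq s (T.edgeFun κ s (n + 1)) = T.edgeLength s / 2 := by
    have h := integral_sin_mul_sin hL n n
    rw [if_pos rfl] at h
    rw [← h]
    refine intervalIntegral.integral_congr fun t ht => ?_
    rw [Set.uIcc_of_le hL.le] at ht
    rw [T.edgeFun_edgeParam hκ hres _ _ ht, Complex.norm_real, Real.norm_eq_abs, sq_abs, sq]
  simp only [edgeCoefficients]
  rw [hin, hnorm]

/-! ### The nodal interpolant on the edges -/

/-- The end points of an edge. -/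
def endpoints : (ℤ × ℤ) ⊕ (ℤ × ℤ) → Finset (ℤ × ℤ)
  | Sum.inl p => {p, (p.1 + 1, p.2)}
  | Sum.inr p => {p, (p.1, p.2 + 1)}

lemma card_endpoints_le (s : (ℤ × ℤ) ⊕ (ℤ × ℤ)) : (endpoints s).card ≤ 2 := by
  cases s <;> exact card_le_two

lemma card_filter_mem_endpoints_le (S : Finset ((ℤ × ℤ) ⊕ (ℤ × ℤ))) (p : ℤ × ℤ) :
    (S.filter fun s => p ∈ endpoints s).card ≤ 4 := by
  have hsub : (S.filter fun s => p ∈ endpoints s) ⊆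
      {Sum.inl p, Sum.inl (p.1 - 1, p.2), Sum.inr p, Sum.inr (p.1, p.2 - 1)} := by
    intro s hs
    have hs' := (mem_filter.1 hs).2
    cases s with
    | inl q =>
      simp only [endpoints, mem_insert, mem_singleton] at hs'
      rcases hs' with rfl | rfl <;> simp
    | inr q =>
      simp only [endpoints, mem_insert, mem_singleton] at hs'
      rcases hs' with rfl | rfl <;> simp
  exact (card_le_card hsub).trans card_le_four

lemma le_abs_cast_mul_add {i j : ℤ} (h0 : i ≠ j) (h1 : i ≠ j - 1) {l t : ℝ} (hl : 0 < l)
    (ht : t ∈ Set.Icc 0 l) : l ≤ |((i : ℝ) - j) * l + t| := by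
  rcases lt_or_gt_of_ne h0 with h | h
  · have h2 : i + 2 ≤ j := by omega
    have h3 : (i : ℝ) + 2 ≤ j := by exact_mod_cast h2
    refine le_trans ?_ (neg_le_abs _)
    nlinarith [ht.1, ht.2]
  · have h2 : j + 1 ≤ i := by omega
    have h3 : (j : ℝ) + 1 ≤ i := by exact_mod_cast h2
    refine le_trans ?_ (le_abs_self _)
    nlinarith [ht.1, ht.2]

/-- A node that is not an end point is either off the grid line of the edge, by at least one
transversal cell side, or on it at distance at least one edge length from the whole edge. -/
lemma nodeFun_edgeParam_eq_zero {κ : ℝ} (hκ : 0 < κ) {s : (ℤ × ℤ) ⊕ (ℤ × ℤ)} {p : ℤ × ℤ}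
    (hp : p ∉ endpoints s) (m : ℕ) {t : ℝ} (ht : t ∈ Set.Icc 0 (T.edgeLength s)) :
    T.nodeFun κ p m (T.edgeParam s t) = 0 := by
  have h1 := T.h₁_pos
  have h2 := T.h₂_pos
  rw [T.nodeFun_eq hκ]
  cases s with
  | inl q =>
    simp only [endpoints, mem_insert, mem_singleton, not_or] at hp
    simp only [edgeLength] at ht
    simp only [edgeParam]
    by_cases hy : q.2 = p.2
    · rw [T.nodeX_of_le, Complex.ofReal_zero, zero_mul]
      have : (T.point q).1 + t - (T.point p).1 = ((q.1 : ℝ) - p.1) * T.h₁ + t := by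
        simp only [point]
        ring
      rw [this]
      refine le_abs_cast_mul_add (fun h => hp.1 (Prod.ext h.symm hy.symm)) (fun h => hp.2 ?_) h1 ht
      exact Prod.ext (by simp only; omega) hy.symm
    · rw [T.nodeY_of_le, mul_zero]
      have : (T.point q).2 - (T.point p).2 = ((q.2 : ℝ) - p.2) * T.h₂ := by
        simp only [point]
        ring
      rw [this, abs_mul, abs_of_pos h2]
      nlinarith [one_le_abs_sub_cast hy]
  | inr q =>
    simp only [endpoints, mem_insert, mem_singleton, not_or] at hp
    simp only [edgeLength] at ht
    simp only [edgeParam]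
    by_cases hx : q.1 = p.1
    · rw [T.nodeY_of_le, mul_zero]
      have : (T.point q).2 + t - (T.point p).2 = ((q.2 : ℝ) - p.2) * T.h₂ + t := by
        simp only [point]
        ring
      rw [this]
      refine le_abs_cast_mul_add (fun h => hp.1 (Prod.ext hx.symm h.symm)) (fun h => hp.2 ?_) h2 ht
      exact Prod.ext hx.symm (by simp only; omega)
    · rw [T.nodeX_of_le, Complex.ofReal_zero, zero_mul]
      have : (T.point q).1 - (T.point p).1 = ((q.1 : ℝ) - p.1) * T.h₁ := by
        simp only [point]
        ring
      rw [this, abs_mul, abs_of_pos h1]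
      nlinarith [one_le_abs_sub_cast hx]

lemma continuous_nodalInterpolant {κ : ℝ} (hκ : 0 < κ) (N : ℕ)
    (β : EuclideanSpace ℂ (T.nodes × Fin N)) : Continuous (T.nodalInterpolant κ N β) :=
  continuous_finsetSum _ fun p _ => continuous_finsetSum _ fun m _ =>
    continuous_const.mul (T.continuous_nodeFun hκ p.1 (m.1 + 1))

/-- The factor 2 counts the end points, N comes from Cauchy–Schwarz in m, and the squared
`modeBound` from the uniform bound of the modes. -/
lemma norm_nodalInterpolant_sq_le {κ : ℝ} (hκ : 0 < κ) (N : ℕ)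
    (β : EuclideanSpace ℂ (T.nodes × Fin N)) (s : (ℤ × ℤ) ⊕ (ℤ × ℤ)) {t : ℝ}
    (ht : t ∈ Set.Icc 0 (T.edgeLength s)) :
    ‖T.nodalInterpolant κ N β (T.edgeParam s t)‖ ^ 2 ≤
      2 * modeBound (2 * (κ * T.h₁)) (κ * T.h₂) ^ 2 * N *
        ∑ p : T.nodes, if p.1 ∈ endpoints s then ∑ m : Fin N, ‖β (p, m)‖ ^ 2 else 0 := by
  set A := modeBound (2 * (κ * T.h₁)) (κ * T.h₂)
  have hA : 0 ≤ A := zero_le_one.trans (one_le_modeBound _ _)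
  set P : Finset T.nodes := univ.filter fun p => p.1 ∈ endpoints s with hP
  have hcard : (P.card : ℝ) ≤ 2 := by
    have : P.card ≤ (endpoints s).card :=
      card_le_card_of_injOn (fun p => p.1) (fun p hp => by simpa [hP] using hp)
        (fun p _ q _ h => Subtype.ext h)
    exact_mod_cast this.trans (card_endpoints_le s)
  have h1 : T.nodalInterpolant κ N β (T.edgeParam s t) =
      ∑ p ∈ P, ∑ m : Fin N, β (p, m) * T.nodeFun κ p.1 (m.1 + 1) (T.edgeParam s t) := by
    rw [nodalInterpolant, hP, sum_filter]
    refine sum_congr rfl fun p _ => ?_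
    split_ifs with hp
    · rfl
    · exact sum_eq_zero fun m _ => by rw [T.nodeFun_edgeParam_eq_zero hκ hp _ ht, mul_zero]
  have h2 : ∀ p ∈ P, ‖∑ m : Fin N, β (p, m) * T.nodeFun κ p.1 (m.1 + 1) (T.edgeParam s t)‖ ^ 2 ≤
      A ^ 2 * N * ∑ m : Fin N, ‖β (p, m)‖ ^ 2 := by
    intro p _
    have h3 : ‖∑ m : Fin N, β (p, m) * T.nodeFun κ p.1 (m.1 + 1) (T.edgeParam s t)‖ ≤
        A * ∑ m : Fin N, ‖β (p, m)‖ := by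
      rw [mul_sum]
      refine norm_sum_le_of_le _ fun m _ => ?_
      rw [norm_mul, mul_comm]
      exact mul_le_mul_of_nonneg_right (T.norm_nodeFun_le hκ _ _ _) (norm_nonneg _)
    calc _ ≤ (A * ∑ m : Fin N, ‖β (p, m)‖) ^ 2 := by gcongr
      _ = A ^ 2 * (∑ m : Fin N, ‖β (p, m)‖) ^ 2 := mul_pow _ _ _
      _ ≤ A ^ 2 * (N * ∑ m : Fin N, ‖β (p, m)‖ ^ 2) := by
          gcongr
          simpa using sq_sum_le_card_mul_sum_sq (s := (univ : Finset (Fin N)))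
            (f := fun m => ‖β (p, m)‖)
      _ = _ := by ring
  rw [← sum_filter, ← hP, h1]
  calc _ ≤ (∑ p ∈ P, ‖∑ m : Fin N, β (p, m) *
          T.nodeFun κ p.1 (m.1 + 1) (T.edgeParam s t)‖) ^ 2 := by
        gcongr
        exact norm_sum_le _ _
    _ ≤ P.card * ∑ p ∈ P, ‖∑ m : Fin N, β (p, m) *
          T.nodeFun κ p.1 (m.1 + 1) (T.edgeParam s t)‖ ^ 2 := sq_sum_le_card_mul_sum_sq
    _ ≤ 2 * ∑ p ∈ P, A ^ 2 * N * ∑ m : Fin N, ‖β (p, m)‖ ^ 2 := by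
        gcongr with p hp
        exact h2 p hp
    _ = _ := by rw [← mul_sum]; ring

/-- After exchanging the sums, each node is counted once per incident edge, hence at most four
times. -/
lemma sum_edges_endpoints_le {N : ℕ} (β : EuclideanSpace ℂ (T.nodes × Fin N)) :
    ∑ s ∈ T.edges, ∑ p : T.nodes,
      (if p.1 ∈ endpoints s then ∑ m : Fin N, ‖β (p, m)‖ ^ 2 else 0) ≤ 4 * ‖β‖ ^ 2 := by
  rw [sum_comm, EuclideanSpace.norm_sq_eq, Fintype.sum_prod_type, mul_sum]
  refine sum_le_sum fun p _ => ?_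
  rw [← sum_filter, sum_const, nsmul_eq_mul]
  have : (((T.edges.filter fun s => p.1 ∈ endpoints s).card : ℕ) : ℝ) ≤ 4 := by
    exact_mod_cast card_filter_mem_endpoints_le T.edges p.1
  gcongr

lemma edgeParam_mem_closure {s : (ℤ × ℤ) ⊕ (ℤ × ℤ)} (hs : s ∈ T.edges) {t : ℝ}
    (ht : t ∈ Set.Icc 0 (T.edgeLength s)) : T.edgeParam s t ∈ closure T.domain := by
  have h1 := T.h₁_pos
  have h2 := T.h₂_pos
  cases s with
  | inl p =>
    rw [edges, inl_mem_disjSum, horizontalEdges, mem_biUnion] at hs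
    obtain ⟨c, hc, hp⟩ := hs
    refine T.closure_cell_subset hc ?_
    rw [closure_cell]
    simp only [edgeLength] at ht
    obtain ⟨ht0, ht1⟩ := ht
    simp only [mem_insert, mem_singleton] at hp
    rcases hp with rfl | rfl <;> simp only [edgeParam, point] <;> push_cast <;>
      refine ⟨⟨?_, ?_⟩, ?_, ?_⟩ <;> nlinarith
  | inr p =>
    rw [edges, inr_mem_disjSum, verticalEdges, mem_biUnion] at hs
    obtain ⟨c, hc, hp⟩ := hs
    refine T.closure_cell_subset hc ?_
    rw [closure_cell]
    simp only [edgeLength] at ht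
    obtain ⟨ht0, ht1⟩ := ht
    simp only [mem_insert, mem_singleton] at hp
    rcases hp with rfl | rfl <;> simp only [edgeParam, point] <;> push_cast <;>
      refine ⟨⟨?_, ?_⟩, ?_, ?_⟩ <;> nlinarith

lemma norm_edgeCoefficients_sq_le {κ : ℝ} (hκ : 0 < κ)
    (hres : κ ^ 2 ∉ neumannEigenvalues (2 * T.h₁) T.h₂) {u : ℝ × ℝ → ℂ}
    (hu : AnalyticOnNhd ℝ u (closure T.domain)) (Ne N : ℕ)
    (β : EuclideanSpace ℂ (T.nodes × Fin N)) :
    ‖T.edgeCoefficients κ Ne (u - T.nodalInterpolant κ N β)‖ ^ 2 ≤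
      (∑ s ∈ T.edges, 4 / T.edgeLength s *
        ∫ t in (0 : ℝ)..T.edgeLength s, ‖u (T.edgeParam s t)‖ ^ 2) +
      32 * modeBound (2 * (κ * T.h₁)) (κ * T.h₂) ^ 2 * N * ‖β‖ ^ 2 := by
  set A := modeBound (2 * (κ * T.h₁)) (κ * T.h₂)
  set V := T.nodalInterpolant κ N β
  have hVc := T.continuous_nodalInterpolant hκ N β
  set R : (ℤ × ℤ) ⊕ (ℤ × ℤ) → ℝ := fun s =>
    ∑ p : T.nodes, if p.1 ∈ endpoints s then ∑ m : Fin N, ‖β (p, m)‖ ^ 2 else 0 with hR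
  have hedge : ∀ s : T.edges, ∑ n : Fin Ne, ‖T.edgeCoefficients κ Ne (u - V) (s, n)‖ ^ 2 ≤
      4 / T.edgeLength s * (∫ t in (0 : ℝ)..T.edgeLength s, ‖u (T.edgeParam s t)‖ ^ 2) +
        8 * A ^ 2 * N * R s := by
    intro s
    have hL := T.edgeLength_pos s
    have huc : ContinuousOn (fun t => u (T.edgeParam s t)) (Set.Icc 0 (T.edgeLength s)) :=
      hu.continuousOn.comp (T.continuous_edgeParam s).continuousOn
        fun t ht => T.edgeParam_mem_closure s.2 ht
    have hVs : Continuous fun t => V (T.edgeParam s t) := hVc.comp (T.continuous_edgeParam s)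
    have hwc : ContinuousOn (fun t => (u - V) (T.edgeParam s t)) (Set.Icc 0 (T.edgeLength s)) :=
      huc.sub hVs.continuousOn
    refine (T.sum_edgeCoefficients_le hκ hres s Ne hwc).trans ?_
    have hi : ∀ f : ℝ → ℂ, ContinuousOn f (Set.Icc 0 (T.edgeLength s)) →
        IntervalIntegrable (fun t => ‖f t‖ ^ 2) volume 0 (T.edgeLength s) := fun f hf =>
      ContinuousOn.intervalIntegrable (by rw [Set.uIcc_of_le hL.le]; exact hf.norm.pow 2)
    have hmono := intervalIntegral.integral_mono_on hL.le (hi _ hwc)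
      (((hi _ huc).const_mul 2).add
        (intervalIntegrable_const (c := 2 * (2 * A ^ 2 * N * R s)))) (fun t ht => by
        -- The pointwise bound |u - V|² ≤ 2|u|² + 2|V|², integrated and multiplied by the Bessel
        -- factor 2/L, gives the constants 4/L and 8; the four edges at a node later turn 8 into 32.
        have hVt := T.norm_nodalInterpolant_sq_le hκ N β s ht
        have h3 : ‖(u - V) (T.edgeParam s t)‖ ≤
            ‖u (T.edgeParam s t)‖ + ‖V (T.edgeParam s t)‖ := norm_sub_le _ _
        have h4 : ‖(u - V) (T.edgeParam s t)‖ ^ 2 ≤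
            2 * ‖u (T.edgeParam s t)‖ ^ 2 + 2 * ‖V (T.edgeParam s t)‖ ^ 2 := by
          nlinarith [sq_nonneg (‖u (T.edgeParam s t)‖ - ‖V (T.edgeParam s t)‖),
            norm_nonneg ((u - V) (T.edgeParam s t))]
        exact h4.trans (add_le_add_right (mul_le_mul_of_nonneg_left hVt zero_le_two) _))
    rw [intervalIntegral.integral_add ((hi _ huc).const_mul 2) intervalIntegrable_const,
      intervalIntegral.integral_const_mul, intervalIntegral.integral_const, smul_eq_mul,
      sub_zero] at hmono
    refine (mul_le_mul_of_nonneg_left hmono (by positivity)).trans (le_of_eq ?_)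
    field_simp
    ring
  rw [EuclideanSpace.norm_sq_eq, Fintype.sum_prod_type]
  refine (sum_le_sum fun s _ => hedge s).trans ?_
  rw [sum_add_distrib, ← mul_sum, sum_coe_sort T.edges fun s => 4 / T.edgeLength s *
    ∫ t in (0 : ℝ)..T.edgeLength s, ‖u (T.edgeParam s t)‖ ^ 2, sum_coe_sort T.edges R]
  have hRs := T.sum_edges_endpoints_le β
  have : 8 * A ^ 2 * N * ∑ s ∈ T.edges, R s ≤ 8 * A ^ 2 * N * (4 * ‖β‖ ^ 2) := by gcongr
  linarith

end Mesh

/-! ### Comparison with the Sobolev norm -/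

/-- The contribution of `∂₁^i ∂₂^j u` to the squared Sobolev norm. -/
def derivTerm (κ : ℝ) (Ω : Set (ℝ × ℝ)) (u : ℝ × ℝ → ℂ) (i j : ℕ) : ℝ :=
  (κ ^ (2 * (i + j)))⁻¹ * ∫ z in Ω, ‖(partialX^[i] (partialY^[j] u)) z‖ ^ 2

lemma derivTerm_nonneg {κ : ℝ} (hκ : 0 < κ) (Ω : Set (ℝ × ℝ)) (u : ℝ × ℝ → ℂ) (i j : ℕ) :
    0 ≤ derivTerm κ Ω u i j :=
  mul_nonneg (by positivity) (integral_nonneg fun _ => by positivity)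

lemma sobolevNorm_sq {κ : ℝ} (hκ : 0 < κ) (M : ℕ) (Ω : Set (ℝ × ℝ)) (u : ℝ × ℝ → ℂ) :
    sobolevNorm κ M Ω u ^ 2 = ∑ a ∈ (range (M + 1) ×ˢ range (M + 1)).filter
      (fun a => a.1 + a.2 ≤ M), derivTerm κ Ω u a.1 a.2 :=
  Real.sq_sqrt (sum_nonneg fun a _ => derivTerm_nonneg hκ Ω u a.1 a.2)

lemma sum_range_two_mul (g : ℕ → ℝ) (N : ℕ) :
    ∑ n ∈ range N, (g (2 * n) + g (2 * n + 1)) = ∑ i ∈ range (2 * N), g i := by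
  induction N with
  | zero => simp
  | succ N ih =>
    rw [sum_range_succ, ih, show 2 * (N + 1) = 2 * N + 1 + 1 by ring, sum_range_succ,
      sum_range_succ]
    ring

/-- The x-orders 2n and 2n + 1 with n < N run through 0, …, 2N - 1 once each. With y-order at most 1
the total order is at most 2N, within the norm, and no constant is lost. -/
lemma sum_derivTerm_le {κ : ℝ} (hκ : 0 < κ) (N : ℕ) (Ω : Set (ℝ × ℝ)) (u : ℝ × ℝ → ℂ) :
    ∑ n ∈ range N, (derivTerm κ Ω u (2 * n) 0 + derivTerm κ Ω u (2 * n) 1 +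
      (derivTerm κ Ω u (2 * n + 1) 0 + derivTerm κ Ω u (2 * n + 1) 1)) ≤
      sobolevNorm κ (2 * N + 1) Ω u ^ 2 := by
  rw [sum_range_two_mul fun i => derivTerm κ Ω u i 0 + derivTerm κ Ω u i 1, sobolevNorm_sq hκ]
  have h : ∑ i ∈ range (2 * N), (derivTerm κ Ω u i 0 + derivTerm κ Ω u i 1) =
      ∑ a ∈ range (2 * N) ×ˢ range 2, derivTerm κ Ω u a.1 a.2 := by
    rw [sum_product]
    exact sum_congr rfl fun i _ => by rw [sum_range_succ, sum_range_one]
  rw [h]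
  refine sum_le_sum_of_subset_of_nonneg ?_ fun a _ _ => derivTerm_nonneg hκ Ω u a.1 a.2
  intro a ha
  simp only [mem_product, mem_range, mem_filter] at ha ⊢
  omega

lemma derivTerms_le_sobolevNorm {κ : ℝ} (hκ : 0 < κ) {N : ℕ} (hN : 1 ≤ N) (Ω : Set (ℝ × ℝ))
    (u : ℝ × ℝ → ℂ) :
    derivTerm κ Ω u 0 0 + derivTerm κ Ω u 0 1 + (derivTerm κ Ω u 1 0 + derivTerm κ Ω u 1 1) ≤
      sobolevNorm κ (2 * N + 1) Ω u ^ 2 := by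
  refine le_trans ?_ (sum_derivTerm_le hκ N Ω u)
  exact single_le_sum (f := fun n => derivTerm κ Ω u (2 * n) 0 + derivTerm κ Ω u (2 * n) 1 +
      (derivTerm κ Ω u (2 * n + 1) 0 + derivTerm κ Ω u (2 * n + 1) 1))
    (fun n _ => add_nonneg (add_nonneg (derivTerm_nonneg hκ _ _ _ _) (derivTerm_nonneg hκ _ _ _ _))
      (add_nonneg (derivTerm_nonneg hκ _ _ _ _) (derivTerm_nonneg hκ _ _ _ _)))
    (mem_range.2 hN)

namespace Mesh

variable (T : Mesh)

/-- The weights h₁² and h₂² of the cell embedding meet the κ⁻² of the norm, so that only κh₁ and κh₂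
remain beside the factor 1/(h₁h₂). -/
lemma sum_nodes_scaledDerivX_le {κ : ℝ} (hκ : 0 < κ) {u : ℝ × ℝ → ℂ}
    (hu : AnalyticOnNhd ℝ u (closure T.domain)) (N : ℕ) :
    ∑ q ∈ T.nodes, ∑ n : Fin N, ‖scaledDerivX κ (2 * n) u (T.point q)‖ ^ 2 ≤
      16 * ((1 + (κ * T.h₁) ^ 2) * (1 + (κ * T.h₂) ^ 2)) / (T.h₁ * T.h₂) *
        sobolevNorm κ (2 * N + 1) T.domain u ^ 2 := by
  have h1 := T.h₁_pos
  have h2 := T.h₂_pos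
  set D := derivTerm κ T.domain u with hD
  set E := (1 + (κ * T.h₁) ^ 2) * (1 + (κ * T.h₂) ^ 2) with hE
  have hterm : ∀ n : ℕ, ∑ q ∈ T.nodes, ‖scaledDerivX κ (2 * n) u (T.point q)‖ ^ 2 ≤
      16 * E / (T.h₁ * T.h₂) *
        (D (2 * n) 0 + D (2 * n) 1 + (D (2 * n + 1) 0 + D (2 * n + 1) 1)) := by
    intro n
    have hf : AnalyticOnNhd ℝ (partialX^[2 * n] u) (closure T.domain) :=
      fun z hz => (hu z hz).partialX_iterate _
    have hsum := T.sum_nodes_norm_sq_le hf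
    have hpt : ∀ q, ‖scaledDerivX κ (2 * n) u (T.point q)‖ ^ 2 =
        (κ ^ (2 * (2 * n)))⁻¹ * ‖(partialX^[2 * n] u) (T.point q)‖ ^ 2 := by
      intro q
      rw [scaledDerivX, norm_mul, mul_pow, norm_inv, norm_pow, Complex.norm_real,
        Real.norm_of_nonneg hκ.le, inv_pow, ← pow_mul, mul_comm (2 * n) 2]
    have hmeas : MeasurableSet T.domain := isOpen_interior.measurableSet
    have i01 : ∫ z in T.domain, ‖partialY (partialX^[2 * n] u) z‖ ^ 2 =
        ∫ z in T.domain, ‖(partialX^[2 * n] (partialY u)) z‖ ^ 2 :=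
      setIntegral_congr_fun hmeas fun z hz => by
        simp only [partialY_partialX_iterate (hu z (subset_closure hz))]
    have i10 : partialX (partialX^[2 * n] u) = partialX^[2 * n + 1] u :=
      (Function.iterate_succ_apply' _ _ _).symm
    have i11 : ∫ z in T.domain, ‖partialY (partialX (partialX^[2 * n] u)) z‖ ^ 2 =
        ∫ z in T.domain, ‖(partialX^[2 * n + 1] (partialY u)) z‖ ^ 2 := by
      rw [i10]
      exact setIntegral_congr_fun hmeas fun z hz => by
        simp only [partialY_partialX_iterate (hu z (subset_closure hz))]
    have e00 : (κ ^ (2 * (2 * n)))⁻¹ * ∫ z in T.domain, ‖(partialX^[2 * n] u) z‖ ^ 2 =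
        D (2 * n) 0 := rfl
    have e01 : (κ ^ (2 * (2 * n)))⁻¹ * (T.h₂ ^ 2 *
        ∫ z in T.domain, ‖partialY (partialX^[2 * n] u) z‖ ^ 2) =
        (κ * T.h₂) ^ 2 * D (2 * n) 1 := by
      rw [i01, hD, derivTerm, show 2 * (2 * n + 1) = 2 * (2 * n) + 2 by ring, pow_add]
      simp only [Function.iterate_one]
      field_simp
    have e10 : (κ ^ (2 * (2 * n)))⁻¹ * (T.h₁ ^ 2 *
        ∫ z in T.domain, ‖partialX (partialX^[2 * n] u) z‖ ^ 2) =
        (κ * T.h₁) ^ 2 * D (2 * n + 1) 0 := by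
      rw [i10, hD, derivTerm, show 2 * (2 * n + 1 + 0) = 2 * (2 * n) + 2 by ring, pow_add]
      simp only [Function.iterate_zero, id]
      field_simp
    have e11 : (κ ^ (2 * (2 * n)))⁻¹ * (T.h₁ ^ 2 * T.h₂ ^ 2 *
        ∫ z in T.domain, ‖partialY (partialX (partialX^[2 * n] u)) z‖ ^ 2) =
        (κ * T.h₁) ^ 2 * (κ * T.h₂) ^ 2 * D (2 * n + 1) 1 := by
      rw [i11, hD, derivTerm, show 2 * (2 * n + 1 + 1) = 2 * (2 * n) + 4 by ring, pow_add]
      simp only [Function.iterate_one]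
      field_simp
    have n00 : 0 ≤ D (2 * n) 0 := derivTerm_nonneg hκ _ _ _ _
    have n01 : 0 ≤ D (2 * n) 1 := derivTerm_nonneg hκ _ _ _ _
    have n10 : 0 ≤ D (2 * n + 1) 0 := derivTerm_nonneg hκ _ _ _ _
    have n11 : 0 ≤ D (2 * n + 1) 1 := derivTerm_nonneg hκ _ _ _ _
    simp only [hpt]
    rw [← mul_sum]
    refine (mul_le_mul_of_nonneg_left hsum (by positivity)).trans ?_
    rw [mul_left_comm, mul_div_right_comm, mul_assoc (16 / (T.h₁ * T.h₂)) E]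
    have hc : 0 ≤ 16 / (T.h₁ * T.h₂) := by positivity
    refine mul_le_mul_of_nonneg_left ?_ hc
    rw [mul_add, mul_add, mul_add, e00, e01, e10, e11]
    have p1 : 0 ≤ (κ * T.h₁) ^ 2 := sq_nonneg _
    have p2 : 0 ≤ (κ * T.h₂) ^ 2 := sq_nonneg _
    have p3 := mul_nonneg p1 p2
    have c00 : D (2 * n) 0 ≤ E * D (2 * n) 0 :=
      le_mul_of_one_le_left n00 (by rw [hE]; nlinarith)
    have c01 : (κ * T.h₂) ^ 2 * D (2 * n) 1 ≤ E * D (2 * n) 1 :=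
      mul_le_mul_of_nonneg_right (by rw [hE]; nlinarith) n01
    have c10 : (κ * T.h₁) ^ 2 * D (2 * n + 1) 0 ≤ E * D (2 * n + 1) 0 :=
      mul_le_mul_of_nonneg_right (by rw [hE]; nlinarith) n10
    have c11 : (κ * T.h₁) ^ 2 * (κ * T.h₂) ^ 2 * D (2 * n + 1) 1 ≤ E * D (2 * n + 1) 1 :=
      mul_le_mul_of_nonneg_right (by rw [hE]; nlinarith) n11
    linarith
  rw [sum_comm, Fin.sum_univ_eq_sum_range
    (fun n => ∑ q ∈ T.nodes, ‖scaledDerivX κ (2 * n) u (T.point q)‖ ^ 2) N]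
  refine (sum_le_sum fun n _ => hterm n).trans ?_
  rw [← mul_sum]
  exact mul_le_mul_of_nonneg_left (sum_derivTerm_le hκ N T.domain u) (by positivity)

lemma sum_edges_trace_le {κ : ℝ} (hκ : 0 < κ) {u : ℝ × ℝ → ℂ}
    (hu : AnalyticOnNhd ℝ u (closure T.domain)) {N : ℕ} (hN : 1 ≤ N) :
    ∑ s ∈ T.edges, 4 / T.edgeLength s *
        (∫ t in (0 : ℝ)..T.edgeLength s, ‖u (T.edgeParam s t)‖ ^ 2) ≤
      32 * ((1 + (κ * T.h₁) ^ 2) * (1 + (κ * T.h₂) ^ 2)) / (T.h₁ * T.h₂) *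
        sobolevNorm κ (2 * N + 1) T.domain u ^ 2 := by
  have h1 := T.h₁_pos
  have h2 := T.h₂_pos
  set D := derivTerm κ T.domain u with hD
  have hS := derivTerms_le_sobolevNorm hκ hN T.domain u
  rw [← hD] at hS
  have e00 : ∫ z in T.domain, ‖u z‖ ^ 2 = D 0 0 := by
    simp [hD, derivTerm]
  have e01 : T.h₂ ^ 2 * ∫ z in T.domain, ‖partialY u z‖ ^ 2 = (κ * T.h₂) ^ 2 * D 0 1 := by
    simp only [hD, derivTerm, Function.iterate_zero, Function.iterate_one, id]
    field_simp
  have e10 : T.h₁ ^ 2 * ∫ z in T.domain, ‖partialX u z‖ ^ 2 = (κ * T.h₁) ^ 2 * D 1 0 := by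
    simp only [hD, derivTerm, Function.iterate_zero, Function.iterate_one, id]
    field_simp
  have hh := T.sum_horizontalEdges_le hu
  have hv := T.sum_verticalEdges_le hu
  rw [e00, e01] at hh
  rw [e00, e10] at hv
  have n00 : 0 ≤ D 0 0 := derivTerm_nonneg hκ _ _ _ _
  have n01 : 0 ≤ D 0 1 := derivTerm_nonneg hκ _ _ _ _
  have n10 : 0 ≤ D 1 0 := derivTerm_nonneg hκ _ _ _ _
  have n11 : 0 ≤ D 1 1 := derivTerm_nonneg hκ _ _ _ _
  rw [edges, sum_disjSum]
  simp only [edgeLength]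
  rw [← mul_sum, ← mul_sum]
  set S := sobolevNorm κ (2 * N + 1) T.domain u ^ 2
  have p1 : 0 ≤ (κ * T.h₁) ^ 2 := sq_nonneg _
  have p2 : 0 ≤ (κ * T.h₂) ^ 2 := sq_nonneg _
  have p3 := mul_nonneg p1 p2
  set x := (κ * T.h₁) ^ 2
  set y := (κ * T.h₂) ^ 2
  have hS0 : 0 ≤ S := by linarith
  have b1 : D 0 0 + y * D 0 1 ≤ (1 + x) * (1 + y) * S := by
    have : D 0 0 + y * D 0 1 ≤ (1 + y) * S := by nlinarith
    nlinarith [mul_nonneg p1 hS0, mul_nonneg p3 hS0]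
  have b2 : D 0 0 + x * D 1 0 ≤ (1 + x) * (1 + y) * S := by
    have : D 0 0 + x * D 1 0 ≤ (1 + x) * S := by nlinarith
    nlinarith [mul_nonneg p2 hS0, mul_nonneg p3 hS0]
  calc _ ≤ 4 / T.h₁ * (4 / T.h₂ * ((1 + x) * (1 + y) * S)) +
        4 / T.h₂ * (4 / T.h₁ * ((1 + x) * (1 + y) * S)) := by
        refine add_le_add (mul_le_mul_of_nonneg_left (hh.trans ?_) (by positivity))
          (mul_le_mul_of_nonneg_left (hv.trans ?_) (by positivity))
        · exact mul_le_mul_of_nonneg_left b1 (by positivity)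
        · exact mul_le_mul_of_nonneg_left b2 (by positivity)
    _ = _ := by
        field_simp
        ring

end Mesh

/-! ### Assembly of the estimates and choice of the constant -/

/-- Stability, with a constant that depends on `κ h₁` and `κ h₂`. -/
theorem stability_of_scaled_sides (a b : ℝ) :
    ∃ c : ℝ, 0 < c ∧ ∀ (κ : ℝ), 0 < κ → ∀ T : Mesh, κ * T.h₁ = a → κ * T.h₂ = b →
        κ ^ 2 ∉ neumannEigenvalues (2 * T.h₁) T.h₂ →
      ∀ u : ℝ × ℝ → ℂ, AnalyticOnNhd ℝ u (closure T.domain) →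
      ∀ Ne Nn : ℕ, 1 ≤ Nn →
        ∃ β : EuclideanSpace ℂ (T.nodes × Fin Nn),
          T.IsCollocationSolution κ Nn u β ∧
          (∀ β' : EuclideanSpace ℂ (T.nodes × Fin Nn),
            T.IsCollocationSolution κ Nn u β' → β' = β) ∧
          ‖T.edgeCoefficients κ Ne (u - T.nodalInterpolant κ Nn β)‖ ≤
            c / T.size * (Nn : ℝ) ^ 2 * sobolevNorm κ (2 * Nn + 1) T.domain u ∧
          ‖β‖ ≤ c / T.size * Real.sqrt Nn * sobolevNorm κ (2 * Nn + 1) T.domain u := by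
  by_cases hab : 0 < a ∧ 0 < b
  swap
  -- If a or b is not positive, no mesh has these scaled sides.
  · refine ⟨1, one_pos, fun κ hκ T ha hb => absurd ⟨?_, ?_⟩ hab⟩
    · rw [← ha]
      exact mul_pos hκ T.h₁_pos
    · rw [← hb]
      exact mul_pos hκ T.h₂_pos
  obtain ⟨ha0, hb0⟩ := hab
  obtain ⟨B, hB0, hB⟩ := Mesh.exists_collocationSolution ha0
  set A := modeBound (2 * a) b
  set E := (1 + a ^ 2) * (1 + b ^ 2) with hE
  have hE0 : 0 < E := by positivity
  -- The scale-invariant ratio h²/(h₁h₂), which trades 1/(h₁h₂) for 1/h².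
  set R := max a b ^ 2 / (a * b) with hR
  have hmax : 0 < max a b := lt_max_of_lt_left ha0
  have hR0 : 0 < R := by positivity
  -- The three terms serve the bound of β, the trace of u, and the trace of the nodal interpolant,
  -- where 512 = 32 · 16.
  set Q := R * (16 * B ^ 2 * E + 32 * E + 512 * A ^ 2 * B ^ 2 * E) with hQ
  have hQ0 : 0 < Q := by positivity
  refine ⟨Real.sqrt Q, Real.sqrt_pos.2 hQ0, fun κ hκ T hTa hTb hres u hu Ne Nn hNn => ?_⟩
  obtain ⟨β, hβ, hβu, hβn⟩ := hB κ hκ T hTa hres u Nn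
  have h1 := T.h₁_pos
  have h2 := T.h₂_pos
  have hsize : 0 < T.size := lt_max_of_lt_left h1
  have hS0 : 0 ≤ sobolevNorm κ (2 * Nn + 1) T.domain u := Real.sqrt_nonneg _
  have hNn1 : (1 : ℝ) ≤ Nn := by exact_mod_cast hNn
  have hκs : κ * T.size = max a b := by
    rw [Mesh.size, mul_max_of_nonneg _ _ hκ.le, hTa, hTb]
  have hinv : 1 / (T.h₁ * T.h₂) = R / T.size ^ 2 := by
    rw [hR, ← hκs, ← hTa, ← hTb]
    field_simp
  have hnode := T.sum_nodes_scaledDerivX_le hκ hu Nn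
  have hedge := T.sum_edges_trace_le hκ hu hNn
  rw [hTa, hTb, ← hE, ← mul_one_div, hinv] at hnode hedge
  set S := sobolevNorm κ (2 * Nn + 1) T.domain u
  set W := R * E / T.size ^ 2 * S ^ 2 with hW
  have hW0 : 0 ≤ W := by positivity
  have hβ2 : ‖β‖ ^ 2 ≤ 16 * B ^ 2 * Nn * W := by
    refine hβn.trans ((mul_le_mul_of_nonneg_left hnode (by positivity)).trans (le_of_eq ?_))
    rw [hW]
    ring
  have hα2 : ‖T.edgeCoefficients κ Ne (u - T.nodalInterpolant κ Nn β)‖ ^ 2 ≤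
      (32 + 512 * A ^ 2 * B ^ 2) * (Nn : ℝ) ^ 4 * W := by
    have h := T.norm_edgeCoefficients_sq_le hκ hres hu Ne Nn β
    rw [hTa, hTb] at h
    -- The squared bound consists of terms of order 1 and `Nn` ^ 2; both are enlarged to `Nn` ^ 4,
    -- the square of the stated growth.
    have hn2 : (Nn : ℝ) ^ 2 ≤ (Nn : ℝ) ^ 4 := pow_le_pow_right₀ hNn1 (by norm_num)
    have hn0 : (1 : ℝ) ≤ (Nn : ℝ) ^ 4 := one_le_pow₀ hNn1
    calc _ ≤ _ := h
      _ ≤ 32 * W + 32 * A ^ 2 * Nn * (16 * B ^ 2 * Nn * W) := by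
          refine add_le_add (hedge.trans (le_of_eq ?_))
            (mul_le_mul_of_nonneg_left hβ2 (by positivity))
          rw [hW]
          ring
      _ = 32 * 1 * W + 512 * A ^ 2 * B ^ 2 * (Nn : ℝ) ^ 2 * W := by ring
      _ ≤ 32 * (Nn : ℝ) ^ 4 * W + 512 * A ^ 2 * B ^ 2 * (Nn : ℝ) ^ 4 * W := by gcongr
      _ = _ := by ring
  refine ⟨β, hβ, hβu, ?_, ?_⟩
  · refine (sq_le_sq₀ (norm_nonneg _) (by positivity)).1 (hα2.trans ?_)
    have : (Real.sqrt Q / T.size * (Nn : ℝ) ^ 2 * S) ^ 2 =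
        (16 * B ^ 2 + 32 + 512 * A ^ 2 * B ^ 2) * (Nn : ℝ) ^ 4 * W := by
      rw [mul_pow, mul_pow, div_pow, Real.sq_sqrt hQ0.le, hQ, hW]
      ring
    rw [this]
    gcongr
    nlinarith [sq_nonneg B]
  · refine (sq_le_sq₀ (norm_nonneg _) (by positivity)).1 (hβ2.trans ?_)
    have : (Real.sqrt Q / T.size * Real.sqrt Nn * S) ^ 2 =
        (16 * B ^ 2 + 32 + 512 * A ^ 2 * B ^ 2) * Nn * W := by
      rw [mul_pow, mul_pow, div_pow, Real.sq_sqrt hQ0.le, Real.sq_sqrt (Nat.cast_nonneg _), hQ, hW]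
      ring
    rw [this]
    gcongr
    nlinarith [sq_nonneg (A * B)]

end Trefftz

end

theorem mainTheorem6 :
    ∃ C : ℝ → ℝ → ℝ, (∀ ρ t : ℝ, 0 < C ρ t) ∧
      ∀ (κ : ℝ), 0 < κ → ∀ T : Trefftz.Mesh,
        κ ^ 2 ∉ Trefftz.neumannEigenvalues (2 * T.h₁) T.h₂ →
      ∀ u : ℝ × ℝ → ℂ, AnalyticOnNhd ℝ u (closure T.domain) →
        Trefftz.IsHelmholtzSolution κ T.domain u →
      ∀ Ne Nn : ℕ, 1 ≤ Ne → 1 ≤ Nn →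
        ∃ β : EuclideanSpace ℂ (T.nodes × Fin Nn),
          T.IsCollocationSolution κ Nn u β ∧
          (∀ β' : EuclideanSpace ℂ (T.nodes × Fin Nn),
            T.IsCollocationSolution κ Nn u β' → β' = β) ∧
          ‖T.edgeCoefficients κ Ne (u - T.nodalInterpolant κ Nn β)‖ ≤
            C T.shape (κ * T.size) / T.size * (Nn : ℝ) ^ 2 *
              Trefftz.sobolevNorm κ (2 * Nn + 1) T.domain u ∧
          ‖β‖ ≤
            C T.shape (κ * T.size) / T.size * Real.sqrt Nn *
              Trefftz.sobolevNorm κ (2 * Nn + 1) T.domain u := by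
  choose c hc0 hc using Trefftz.stability_of_scaled_sides
  -- The pair (κh₁, κh₂) consists of t = κh and t/ρ, in an order that ρ and κh do not determine;
  -- adding the constants for both orders covers either case.
  refine ⟨fun ρ t => c t (t / ρ) + c (t / ρ) t, fun ρ t => add_pos (hc0 _ _) (hc0 _ _), ?_⟩
  intro κ hκ T hres u hu _ Ne Nn _ hNn
  have h1 := T.h₁_pos
  have h2 := T.h₂_pos
  have hsize : 0 < T.size := lt_max_of_lt_left h1
  obtain ⟨β, hβ, hβu, hα, hβn⟩ := hc (κ * T.h₁) (κ * T.h₂) κ hκ T rfl rfl hres u hu Ne Nn hNn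
  have hS0 : 0 ≤ Trefftz.sobolevNorm κ (2 * Nn + 1) T.domain u := Real.sqrt_nonneg _
  have hle : c (κ * T.h₁) (κ * T.h₂) ≤
      c (κ * T.size) (κ * T.size / T.shape) + c (κ * T.size / T.shape) (κ * T.size) := by
    have hmin : κ * T.size / T.shape = κ * min T.h₁ T.h₂ := by
      have : 0 < min T.h₁ T.h₂ := lt_min h1 h2
      rw [Trefftz.Mesh.shape]
      field_simp
    rw [hmin, Trefftz.Mesh.size]
    rcases le_total T.h₁ T.h₂ with h | h
    · rw [max_eq_right h, min_eq_left h]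
      exact le_add_of_nonneg_left (hc0 _ _).le
    · rw [max_eq_left h, min_eq_right h]
      exact le_add_of_nonneg_right (hc0 _ _).le
  refine ⟨β, hβ, hβu, hα.trans ?_, hβn.trans ?_⟩ <;> gcongr
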